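/- Let $\lambda=(\lambda_1\ge\lambda_2\ge\cdots)$ be a partition with transpose $\lambda'$, and let $s_\nu$ denote the Schur function of a partition $\nu$. Let $j,k\ge 0$ be integers such that $k=0$ or $k\ge\lambda_2$, and $j=0$ or $j\ge\lambda'_2$ (absent parts count as $0$). For $n\ge 0$ put $\lambda^{(n)}=(\lambda\cup(1^{nj}))+(nk)$: the partition obtained by adjoining $nj$ parts equal to $1$ to $\lambda$ and then adding $nk$ to the first part. Then the sequence $s_{\lambda^{(0)}},s_{\lambda^{(1)}},s_{\lambda^{(2)}},\dots$ is strongly Schur log-concave; that is, for all $n\ge1$ and all $i\ge0$ the symmetric function $$s_{\lambda^{(n+i)}}\,s_{\lambda^{(n)}}-s_{\lambda^{(n+i+1)}}\,s_{\lambda^{(n-1)}}$$ is Schur positive: it is a linear combination of Schur functions with nonnegative coefficients. -/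

import Mathlib

namespace SchurLC

/-- The union of two partitions: the partition formed by sorting all the parts of `μ` and `ν`
together into weakly decreasing order. -/
def partUnion (μ ν : YoungDiagram) : YoungDiagram :=
  YoungDiagram.ofRowLens (((μ.rowLens ++ ν.rowLens : List ℕ) : Multiset ℕ).sort (· ≥ ·))
    (Multiset.pairwise_sort _ _).sortedGE

/-- The entrywise sum of two partitions: its `i`-th part is the sum of the `i`-th parts
of `μ` and of `ν`. -/
def partAdd (μ ν : YoungDiagram) : YoungDiagram :=
  YoungDiagram.ofRowLens
    ((List.range (max (μ.colLen 0) (ν.colLen 0))).map fun i => μ.rowLen i + ν.rowLen i)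
    (List.Pairwise.sortedGE (List.pairwise_le_range.map _ fun a b h =>
      Nat.add_le_add (μ.rowLen_anti a b h) (ν.rowLen_anti a b h)))

/-- The partition `(1^m)`, a single column with `m` cells (empty for `m = 0`). -/
def onesPart (m : ℕ) : YoungDiagram :=
  YoungDiagram.ofRowLens (List.replicate m 1)
    (List.Pairwise.sortedGE (List.pairwise_replicate.2 (Or.inr (Nat.le_refl 1))))

/-- The partition `(m)`, a single row with `m` cells (empty for `m = 0`). -/
def rowPart (m : ℕ) : YoungDiagram :=
  YoungDiagram.ofRowLens [m] (List.pairwise_singleton _ _).sortedGE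

/-- The content of a semistandard tableau, recorded as the function sending a letter to its
number of occurrences; equivalently, the exponent vector of the monomial `x^T`. -/
noncomputable def content {μ : YoungDiagram} (T : SemistandardYoungTableau μ) : ℕ →₀ ℕ :=
  ∑ c ∈ μ.cells, Finsupp.single (T c.1 c.2) 1

/-- Only finitely many tableaux of a given shape have a given content, so that the generating
function below is well defined. -/
theorem finite_content (μ : YoungDiagram) (d : ℕ →₀ ℕ) :
    Finite {T : SemistandardYoungTableau μ // content T = d} := by
  have hmem : ∀ T : {T : SemistandardYoungTableau μ // content T = d}, ∀ c : μ.cells,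
      T.1 c.1.1 c.1.2 ∈ d.support := by
    rintro ⟨T, rfl⟩ c
    rw [Finsupp.mem_support_iff]; unfold content; rw [Finsupp.finsetSum_apply]
    have h := Finset.single_le_sum
      (f := fun e : ℕ × ℕ => Finsupp.single (T e.1 e.2) (1 : ℕ) (T c.1.1 c.1.2))
      (fun _ _ => Nat.zero_le _) c.2
    simp only [Finsupp.single_eq_same] at h
    exact (Nat.lt_of_lt_of_le Nat.zero_lt_one h).ne'
  refine Finite.of_injective
    (fun T => fun c : μ.cells => (⟨T.1 c.1.1 c.1.2, hmem T c⟩ : d.support)) ?_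
  intro S T h
  apply Subtype.ext
  ext i j
  by_cases hc : (i, j) ∈ μ
  · exact congrArg Subtype.val (congrFun h ⟨(i, j), hc⟩)
  · rw [S.1.zeros hc, T.1.zeros hc]

/-- The Schur function `s_μ = ∑_T x^T`, the sum over all semistandard Young tableaux `T` of
shape `μ`, as a formal power series over `ℚ` in the variables `x_0, x_1, x_2, …`: the coefficient
of a monomial is the number of tableaux with that content. -/
noncomputable def schur (μ : YoungDiagram) : MvPowerSeries ℕ ℚ :=
  fun d => (Nat.card {T : SemistandardYoungTableau μ // content T = d} : ℚ)

/-- A power series is Schur positive if it is a (finite) linear combination of Schur functions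
with nonnegative coefficients. -/
def SchurPositive (f : MvPowerSeries ℕ ℚ) : Prop :=
  ∃ c : YoungDiagram →₀ ℚ, (∀ ν, 0 ≤ c ν) ∧ f = c.sum fun ν a => a • schur ν

/-- Strong Schur log-concavity of a sequence `f 0, f 1, f 2, …`. -/
def StronglySchurLogConcave (f : ℕ → MvPowerSeries ℕ ℚ) : Prop :=
  ∀ n i : ℕ, 1 ≤ n → SchurPositive (f (n + i) * f n - f (n + i + 1) * f (n - 1))

end SchurLC

namespace SchurLC

/-! Let (x, y) stand for the diagram obtained from λ by adding x cells to the first row and y parts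
equal to 1. The difference in question telescopes through an intermediate product in which the first
rows have already been changed and the first columns have not. So it suffices to treat two moves
from the larger diagram to the smaller one: k cells of the first row (`schurPositive_row_move`) and
j cells of the first column (`schurPositive_col_move`).

The row move is an injection between Littlewood–Richardson tableaux. By `schur_mul`, s_P s_Q is a
sum over tableaux of shape Q whose letters, read row by row from right to left, can be added to P
through partitions: p(r+1) plus the number of letters r+1 in rows up to i never exceeds p(r) plus
the number of letters r in rows before i. Removing k cells from the first row of P and prepending k
letters 0 to the first row of Q keeps the resulting partition. The only constraint that can suffer
is the one on letters 1 in the first row, which are read before the new zeros; it holds because the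
second row of P' plus the first row of Q is at most the first row of P'. The bounds on k and j
supply this inequality and its transpose. Tableaux outside the image give the positive remainder.

The column move is the transpose of the row move. In place of a ring homomorphism ω, the span of the
pairs (s_ν, s_ν') is shown to be stable under multiplication by such pairs, using the two Pieri
rules (`stabilizes_schurPair`); linear independence of Schur functions then carries the coefficients
over.

The Littlewood–Richardson rule itself comes from alternants. Tableaux are encoded as Gelfand–Tsetlin
patterns; a Bender–Knuth toggle applied only after the first violation of the condition is a
sign-reversing involution, and what survives is the rule (`alternant_mul_schurEval`). -/

section

open Finset

/-! ### Gelfand–Tsetlin patterns and their weights -/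

/-- `g` is a Gelfand–Tsetlin pattern with `N` levels and top row `q`: in terms of tableaux,
`g r i` counts the entries of row `i` that are smaller than `r`. -/
structure IsGT (N : ℕ) (q : ℕ → ℕ) (g : ℕ → ℕ → ℕ) : Prop where
  bot : ∀ i, g 0 i = 0
  top : ∀ r i, N ≤ r → g r i = q i
  mono : ∀ r i, g r i ≤ g (r + 1) i
  inter : ∀ r i, g (r + 1) (i + 1) ≤ g r i

/-- The sum of the first `i` entries of the `r`-th level. -/
def psum (g : ℕ → ℕ → ℕ) (r i : ℕ) : ℕ := ∑ t ∈ range i, g r t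

@[simp] theorem psum_zero (g : ℕ → ℕ → ℕ) (r : ℕ) : psum g r 0 = 0 := rfl

theorem psum_succ (g : ℕ → ℕ → ℕ) (r i : ℕ) : psum g r (i + 1) = psum g r i + g r i :=
  sum_range_succ _ _

/-- The weight of a pattern: `wt g r` is the number of letters `r`. -/
def wt (g : ℕ → ℕ → ℕ) (r : ℕ) : ℕ := psum g (r + 1) (r + 1) - psum g r r

namespace IsGT

variable {N : ℕ} {q : ℕ → ℕ} {g : ℕ → ℕ → ℕ}

theorem mono_le (h : IsGT N q g) (i : ℕ) : Monotone fun r => g r i :=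
  monotone_nat_of_le_succ fun r => h.mono r i

theorem eq_zero (h : IsGT N q g) : ∀ r i, r ≤ i → g r i = 0
  | 0, i, _ => h.bot i
  | r + 1, 0, hi => by omega
  | r + 1, i + 1, hi => by
    have h1 := h.inter r i
    rw [h.eq_zero r i (by omega)] at h1
    omega

theorem le_top (h : IsGT N q g) (r i : ℕ) : g r i ≤ q i := by
  rw [← h.top (max r N) i (le_max_right _ _)]
  exact h.mono_le i (le_max_left _ _)

theorem top_eq_zero (h : IsGT N q g) (i : ℕ) (hi : N ≤ i) : q i = 0 := by
  rw [← h.top N i le_rfl]; exact h.eq_zero N i hi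

theorem anti (h : IsGT N q g) (r : ℕ) : Antitone (g r) :=
  antitone_nat_of_succ_le fun i => (h.mono r (i + 1)).trans (h.inter r i)

theorem anti_top (h : IsGT N q g) : Antitone q := by
  have h1 := h.anti N
  rwa [show g N = q from funext fun i => h.top N i le_rfl] at h1

theorem psum_of_le (h : IsGT N q g) (r : ℕ) {M : ℕ} (hM : r ≤ M) : psum g r M = psum g r r := by
  induction M, hM using Nat.le_induction with
  | base => rfl
  | succ M hM ih => rw [psum_succ, ih, h.eq_zero r M hM, add_zero]

theorem psum_mono (h : IsGT N q g) (r i : ℕ) : psum g r i ≤ psum g (r + 1) i :=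
  sum_le_sum fun t _ => h.mono r t

theorem wt_add (h : IsGT N q g) (r : ℕ) : wt g r + psum g r r = psum g (r + 1) (r + 1) := by
  have h1 := h.psum_mono r (r + 1)
  rw [h.psum_of_le r (Nat.le_succ r)] at h1
  unfold wt; omega

/-- The weight computed with any sufficiently long partial sums. -/
theorem wt_add_of_le (h : IsGT N q g) {r M : ℕ} (hM : r < M) :
    wt g r + psum g r M = psum g (r + 1) M := by
  rw [h.psum_of_le r hM.le, h.psum_of_le (r + 1) hM, h.wt_add]

theorem wt_eq_zero (h : IsGT N q g) {r : ℕ} (hr : N ≤ r) : wt g r = 0 := by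
  have h1 : wt g r + psum g r (r + 1) = _ := h.wt_add_of_le (Nat.lt_succ_self r)
  have h2 : psum g (r + 1) (r + 1) = psum g r (r + 1) :=
    sum_congr rfl fun t _ => by rw [h.top r t hr, h.top (r + 1) t (by omega)]
  omega

theorem sum_wt (h : IsGT N q g) (r : ℕ) : ∑ s ∈ range r, wt g s = psum g r r := by
  induction r with
  | zero => rfl
  | succ r ih => rw [sum_range_succ, ih, add_comm, h.wt_add]

end IsGT

/-- A pattern is determined by its block of levels and rows below `N`, whose entries are bounded by
`q 0`. -/
theorem finite_isGT (N : ℕ) (q : ℕ → ℕ) : {g | IsGT N q g}.Finite := by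
  have key : Function.Injective (fun (g : {g | IsGT N q g}) (r i : Fin N) =>
      (⟨g.1 r i, Nat.lt_succ_of_le ((g.2.le_top r i).trans (g.2.anti_top (Nat.zero_le _)))⟩ :
        Fin (q 0 + 1))) := by
    intro g g' h
    apply Subtype.ext
    funext r i
    by_cases hr : r < N
    · by_cases hi : i < N
      · exact congrArg Fin.val (congrFun (congrFun h ⟨r, hr⟩) ⟨i, hi⟩)
      · rw [g.2.eq_zero r i (by omega), g'.2.eq_zero r i (by omega)]
    · rw [g.2.top r i (by omega), g'.2.top r i (by omega)]
  exact Set.finite_coe_iff.1 (Finite.of_injective _ key)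

/-- The finite set of patterns with `N` levels and top row `q`. -/
noncomputable def gtPatterns (N : ℕ) (q : ℕ → ℕ) : Finset (ℕ → ℕ → ℕ) :=
  (finite_isGT N q).toFinset

@[simp] theorem mem_gtPatterns {N : ℕ} {q : ℕ → ℕ} {g : ℕ → ℕ → ℕ} :
    g ∈ gtPatterns N q ↔ IsGT N q g := by
  simp [gtPatterns]

/-! ### Toggling one level of a pattern -/

/-- The smallest value allowed at position `(r + 1, t)` given the neighbouring levels. -/
def toggleLo (g : ℕ → ℕ → ℕ) (r t : ℕ) : ℕ := max (g (r + 2) (t + 1)) (g r t)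

/-- The largest value used when reflecting position `(r + 1, t)`: it is `C` in row `i`, and the
largest value allowed by the neighbouring levels in the rows below. -/
def toggleHi (g : ℕ → ℕ → ℕ) (r i C t : ℕ) : ℕ :=
  if t = i then C else min (g (r + 2) t) (g r (t - 1))

/-- The partial Bender–Knuth move: level `r + 1` is reflected in the rows from `i` on. -/
def toggle (g : ℕ → ℕ → ℕ) (r i C : ℕ) : ℕ → ℕ → ℕ := fun s t =>
  if s = r + 1 ∧ i ≤ t then toggleLo g r t + toggleHi g r i C t - g (r + 1) t else g s t

theorem toggle_of_ne {g : ℕ → ℕ → ℕ} {r i C s : ℕ} (hs : s ≠ r + 1) :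
    toggle g r i C s = g s := by
  funext t; simp [toggle, hs]

theorem toggle_of_lt {g : ℕ → ℕ → ℕ} {r i C s t : ℕ} (ht : t < i) :
    toggle g r i C s t = g s t := by
  simp [toggle, Nat.not_le.2 ht]

theorem toggle_of_le {g : ℕ → ℕ → ℕ} {r i C t : ℕ} (ht : i ≤ t) :
    toggle g r i C (r + 1) t = toggleLo g r t + toggleHi g r i C t - g (r + 1) t := by
  simp [toggle, ht]

theorem toggleLo_toggle (g : ℕ → ℕ → ℕ) (r i C t : ℕ) :
    toggleLo (toggle g r i C) r t = toggleLo g r t := by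
  simp only [toggleLo, toggle_of_ne (show r + 2 ≠ r + 1 by omega),
    toggle_of_ne (show r ≠ r + 1 by omega)]

theorem toggleHi_toggle (g : ℕ → ℕ → ℕ) (r i C t : ℕ) :
    toggleHi (toggle g r i C) r i C t = toggleHi g r i C t := by
  simp only [toggleHi, toggle_of_ne (show r + 2 ≠ r + 1 by omega),
    toggle_of_ne (show r ≠ r + 1 by omega)]

/-- The bounds under which `toggle g r i C` is again a pattern. -/
structure Toggleable (g : ℕ → ℕ → ℕ) (r i C : ℕ) : Prop where
  le : g (r + 1) i ≤ C
  le_up : C ≤ g (r + 2) i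
  le_down : 0 < i → C ≤ g r (i - 1)

section Toggle

variable {N : ℕ} {q : ℕ → ℕ} {g : ℕ → ℕ → ℕ} {r i C : ℕ}

theorem IsGT.toggleLo_le (h : IsGT N q g) (t : ℕ) : toggleLo g r t ≤ g (r + 1) t :=
  max_le (h.inter (r + 1) t) (h.mono r t)

theorem IsGT.le_toggleHi (h : IsGT N q g) (hT : Toggleable g r i C) {t : ℕ} (ht : i ≤ t) :
    g (r + 1) t ≤ toggleHi g r i C t := by
  unfold toggleHi
  split_ifs with hti
  · exact hti ▸ hT.le
  · obtain ⟨u, rfl⟩ : ∃ u, t = u + 1 := ⟨t - 1, by omega⟩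
    exact le_min (h.mono (r + 1) _) (h.inter r u)

theorem toggleHi_le_up (hT : Toggleable g r i C) {t : ℕ} :
    toggleHi g r i C t ≤ g (r + 2) t := by
  unfold toggleHi
  split_ifs with hti
  · exact hti ▸ hT.le_up
  · exact min_le_left _ _

theorem toggleHi_le_down (hT : Toggleable g r i C) {t : ℕ} :
    toggleHi g r i C (t + 1) ≤ g r t := by
  unfold toggleHi
  split_ifs with hti
  · have := hT.le_down (by omega)
    rwa [← hti] at this
  · exact min_le_right _ _

theorem IsGT.toggleLo_le_toggle (h : IsGT N q g) (hT : Toggleable g r i C) (t : ℕ) :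
    toggleLo g r t ≤ toggle g r i C (r + 1) t := by
  by_cases ht : i ≤ t
  · rw [toggle_of_le ht]
    have := h.le_toggleHi hT ht
    omega
  · rw [toggle_of_lt (by omega)]; exact h.toggleLo_le t

theorem IsGT.toggle_le_up (h : IsGT N q g) (hT : Toggleable g r i C) (t : ℕ) :
    toggle g r i C (r + 1) t ≤ g (r + 2) t := by
  by_cases ht : i ≤ t
  · rw [toggle_of_le ht]
    have h1 := h.toggleLo_le (r := r) t
    have h2 := toggleHi_le_up hT (t := t)
    omega
  · rw [toggle_of_lt (by omega)]; exact h.mono _ _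

theorem IsGT.toggle_le_down (h : IsGT N q g) (hT : Toggleable g r i C) (t : ℕ) :
    toggle g r i C (r + 1) (t + 1) ≤ g r t := by
  by_cases ht : i ≤ t + 1
  · rw [toggle_of_le ht]
    have h1 := h.toggleLo_le (r := r) (t + 1)
    have h2 := toggleHi_le_down hT (t := t)
    omega
  · rw [toggle_of_lt (by omega)]; exact h.inter _ _

theorem IsGT.isGT_toggle (h : IsGT N q g) (hT : Toggleable g r i C) (hr : r + 1 < N) :
    IsGT N q (toggle g r i C) where
  bot t := by rw [toggle_of_ne (by omega)]; exact h.bot t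
  top s t hs := by rw [toggle_of_ne (by omega)]; exact h.top s t hs
  mono s t := by
    by_cases h1 : s = r + 1
    · subst h1
      rw [toggle_of_ne (show r + 1 + 1 ≠ r + 1 by omega)]
      exact h.toggle_le_up hT t
    · by_cases h2 : s = r
      · subst h2
        rw [toggle_of_ne h1]
        exact (le_max_right _ _).trans (h.toggleLo_le_toggle hT t)
      · rw [toggle_of_ne h1, toggle_of_ne (by omega)]; exact h.mono s t
  inter s t := by
    by_cases h1 : s = r + 1
    · subst h1
      rw [toggle_of_ne (show r + 1 + 1 ≠ r + 1 by omega)]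
      exact (le_max_left _ _).trans (h.toggleLo_le_toggle hT t)
    · by_cases h2 : s = r
      · subst h2
        rw [toggle_of_ne h1]
        exact h.toggle_le_down hT t
      · rw [toggle_of_ne h1, toggle_of_ne (by omega)]; exact h.inter s t

theorem IsGT.toggle_toggle (h : IsGT N q g) (hT : Toggleable g r i C) :
    toggle (toggle g r i C) r i C = g := by
  funext s t
  by_cases hs : s = r + 1
  · subst hs
    by_cases ht : i ≤ t
    · rw [toggle_of_le ht, toggleLo_toggle, toggleHi_toggle, toggle_of_le ht]
      have h1 := h.toggleLo_le (r := r) t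
      have h2 := h.le_toggleHi hT ht
      omega
    · rw [toggle_of_lt (by omega), toggle_of_lt (by omega)]
  · rw [toggle_of_ne hs, toggle_of_ne hs]

theorem IsGT.toggleable_toggle (h : IsGT N q g) (hT : Toggleable g r i C) :
    Toggleable (toggle g r i C) r i C where
  le := by
    rw [toggle_of_le le_rfl, toggleHi, if_pos rfl]
    have := h.toggleLo_le (r := r) i
    omega
  le_up := by rw [toggle_of_ne (by omega)]; exact hT.le_up
  le_down := by rw [toggle_of_ne (by omega)]; exact hT.le_down

theorem psum_toggle_of_le {s t : ℕ} (ht : t ≤ i) : psum (toggle g r i C) s t = psum g s t :=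
  sum_congr rfl fun u hu => toggle_of_lt (by have := mem_range.1 hu; omega)

theorem psum_toggle_of_ne {s t : ℕ} (hs : s ≠ r + 1) :
    psum (toggle g r i C) s t = psum g s t := by
  unfold psum; rw [toggle_of_ne hs]

/-- The sums of lower and upper bounds telescope: the lower bound in row t is a maximum and the
upper bound in row t + 1 is the minimum of the same two numbers, so together they give their sum.
Everything is kept on the additive side to avoid truncated subtraction. -/
theorem IsGT.psum_toggle_aux (h : IsGT N q g) (hT : Toggleable g r i C) (m : ℕ) :
    psum (toggle g r i C) (r + 1) (i + m + 1) + psum g (r + 1) (i + m + 1)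
        + psum g (r + 2) (i + 1) + psum g r i
      = 2 * psum g (r + 1) i + C + psum g (r + 2) (i + m + 1) + psum g r (i + m)
        + toggleLo g r (i + m) := by
  induction m with
  | zero =>
    simp only [add_zero, psum_succ, psum_toggle_of_le le_rfl, toggle_of_le le_rfl]
    have h1 := h.toggleLo_le (r := r) i
    have h2 := hT.le
    simp only [toggleHi, if_true]
    omega
  | succ m ih =>
    rw [← add_assoc i m 1, psum_succ _ _ (i + m + 1), psum_succ _ _ (i + m + 1),
      psum_succ _ (r + 2) (i + m + 1), psum_succ _ r (i + m), toggle_of_le (by omega)]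
    have h1 := h.toggleLo_le (r := r) (i + m + 1)
    have h2 := h.le_toggleHi hT (show i ≤ i + m + 1 by omega)
    have h3 : toggleLo g r (i + m) + toggleHi g r i C (i + m + 1)
        = g (r + 2) (i + m + 1) + g r (i + m) := by
      rw [toggleHi, if_neg (by omega), toggleLo, Nat.add_sub_cancel]
      exact max_add_min _ _
    omega

/-- The effect of a toggle on the size of level `r + 1`. -/
theorem IsGT.psum_toggle (h : IsGT N q g) (hT : Toggleable g r i C) (hr : r + 1 < N) :
    psum (toggle g r i C) (r + 1) (r + 1) + psum g (r + 1) (r + 1)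
        + psum g (r + 2) (i + 1) + psum g r i
      = 2 * psum g (r + 1) i + C + psum g (r + 2) (r + 2) + psum g r r := by
  have h1 := h.psum_toggle_aux hT (r + 2)
  have h' := h.isGT_toggle hT hr
  rw [h'.psum_of_le (r + 1) (by omega), h.psum_of_le (r + 1) (by omega),
    h.psum_of_le (r + 2) (M := i + (r + 2) + 1) (by omega),
    h.psum_of_le r (M := i + (r + 2)) (by omega), toggleLo,
    h.eq_zero (r + 2) _ (by omega), h.eq_zero r _ (by omega)] at h1
  simpa using h1

theorem wt_toggle_of_ne {s : ℕ} (h1 : s ≠ r) (h2 : s ≠ r + 1) :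
    wt (toggle g r i C) s = wt g s := by
  unfold wt
  rw [psum_toggle_of_ne (by omega), psum_toggle_of_ne (by omega)]

/-- The multiplicities of `r` and `r + 1` are exchanged up to opposite shifts, which depend only on
`C` and on partial sums that the toggle leaves alone. For `i = 0` and `C = g (r + 2) 0` the shift
vanishes, giving the classical Bender–Knuth involution; choosing `C` differently prescribes the
shift. -/
theorem IsGT.wt_toggle (h : IsGT N q g) (hT : Toggleable g r i C) (hr : r + 1 < N) :
    wt (toggle g r i C) r + psum g (r + 2) (i + 1) + psum g r i
      = 2 * psum g (r + 1) i + C + wt g (r + 1) ∧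
    wt (toggle g r i C) (r + 1) + 2 * psum g (r + 1) i + C
      = wt g r + psum g (r + 2) (i + 1) + psum g r i := by
  have h' := h.isGT_toggle hT hr
  have e1 := h.wt_add r
  have e2 : wt g (r + 1) + _ = psum g (r + 2) (r + 2) := h.wt_add (r + 1)
  have e3 := h'.wt_add r
  have e4 : wt (toggle g r i C) (r + 1) + _ = psum _ (r + 2) (r + 2) := h'.wt_add (r + 1)
  rw [psum_toggle_of_ne (show r ≠ r + 1 by omega)] at e3
  rw [psum_toggle_of_ne (show r + 2 ≠ r + 1 by omega)] at e4
  have e5 := h.psum_toggle hT hr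
  constructor <;> omega

end Toggle

/-! ### Symmetry -/

section Symmetry

variable {A : Type*} [CommRing A]

/-- The monomial of a pattern. -/
def wtMon (N : ℕ) (y : Fin N → A) (g : ℕ → ℕ → ℕ) : A := ∏ r : Fin N, y r ^ wt g r

/-- The toggle of the whole level, with the neighbouring level as bound in row 0, is the
Bender–Knuth involution and exchanges the two exponents. -/
theorem sum_wtMon_swap {N : ℕ} (q : ℕ → ℕ) (y : Fin N → A) {r : ℕ} (hr : r + 1 < N) :
    ∑ g ∈ gtPatterns N q, wtMon N (y ∘ Equiv.swap ⟨r, by omega⟩ ⟨r + 1, hr⟩) g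
      = ∑ g ∈ gtPatterns N q, wtMon N y g := by
  have hT : ∀ g, IsGT N q g → Toggleable g r 0 (g (r + 2) 0) := fun g hg =>
    ⟨hg.mono _ _, le_rfl, fun h => absurd h (lt_irrefl _)⟩
  have hC : ∀ g : ℕ → ℕ → ℕ, toggle g r 0 (g (r + 2) 0) (r + 2) 0 = g (r + 2) 0 := fun g => by
    rw [toggle_of_ne (by omega)]
  have hinv : ∀ g ∈ gtPatterns N q, toggle (toggle g r 0 (g (r + 2) 0)) r 0
      (toggle g r 0 (g (r + 2) 0) (r + 2) 0) = g := fun g hg => by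
    rw [hC]; exact (mem_gtPatterns.1 hg).toggle_toggle (hT g (mem_gtPatterns.1 hg))
  have hmem : ∀ g ∈ gtPatterns N q, toggle g r 0 (g (r + 2) 0) ∈ gtPatterns N q := fun g hg =>
    mem_gtPatterns.2 ((mem_gtPatterns.1 hg).isGT_toggle (hT g (mem_gtPatterns.1 hg)) hr)
  refine sum_nbij' (fun g => toggle g r 0 (g (r + 2) 0)) (fun g => toggle g r 0 (g (r + 2) 0))
    hmem hmem hinv hinv fun g hg => ?_
  have hg' := mem_gtPatterns.1 hg
  obtain ⟨h1, h2⟩ := hg'.wt_toggle (hT g hg') hr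
  simp only [psum_zero, zero_add, psum_succ] at h1 h2
  unfold wtMon
  refine Fintype.prod_equiv (Equiv.swap ⟨r, by omega⟩ ⟨r + 1, hr⟩) _ _ fun s => ?_
  simp only [Function.comp_apply]
  congr 1
  by_cases hs : s = ⟨r, by omega⟩
  · subst hs; rw [Equiv.swap_apply_left]; simp only; omega
  by_cases hs' : s = ⟨r + 1, hr⟩
  · subst hs'; rw [Equiv.swap_apply_right]; simp only; omega
  · rw [Equiv.swap_apply_of_ne_of_ne hs hs', wt_toggle_of_ne]
    · exact fun h => hs (Fin.ext h)
    · exact fun h => hs' (Fin.ext h)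

theorem sum_wtMon_perm {N : ℕ} (q : ℕ → ℕ) (w : Equiv.Perm (Fin N)) (y : Fin N → A) :
    ∑ g ∈ gtPatterns N q, wtMon N (y ∘ w) g = ∑ g ∈ gtPatterns N q, wtMon N y g := by
  cases N with
  | zero => exact sum_congr rfl fun g _ => by simp [wtMon]
  | succ n =>
    have hw : w ∈ Submonoid.closure
        (Set.range fun i : Fin n => Equiv.swap i.castSucc i.succ) := by
      rw [Equiv.Perm.mclosure_swap_castSucc_succ]; trivial
    induction hw using Submonoid.closure_induction generalizing y with
    | mem x hx =>
      obtain ⟨i, rfl⟩ := hx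
      exact sum_wtMon_swap q y (r := i) (by omega)
    | one => rfl
    | mul a b _ _ ha hb =>
      rw [show y ∘ (a * b : Equiv.Perm (Fin (n + 1))) = (y ∘ a) ∘ b from rfl, hb, ha]

end Symmetry

/-! ### Alternants and the Littlewood–Richardson rule in finitely many variables -/

section Alternant

variable {A : Type*} [CommRing A]

/-- The alternant `det (y i ^ α j)`. -/
def alternant (N : ℕ) (y : Fin N → A) (α : Fin N → ℕ) : A :=
  Matrix.det (Matrix.of fun i j => y i ^ α j)

theorem alternant_comp {N : ℕ} (y : Fin N → A) (α : Fin N → ℕ) (w : Equiv.Perm (Fin N)) :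
    alternant N y (α ∘ w) = (Equiv.Perm.sign w : ℤ) * alternant N y α := by
  unfold alternant
  rw [← Matrix.det_permute']
  rfl

/-- The staircase exponents `N - 1, …, 1, 0`. -/
def stair (N r : ℕ) : ℕ := N - 1 - r

/-- Expand the determinant over permutations `w`; by symmetry the sum over patterns in the term of
`w` may be evaluated at `y ∘ w`, and then its monomials merge with those of the determinant. -/
theorem alternant_mul_sum {N : ℕ} (q : ℕ → ℕ) (y : Fin N → A) (α : Fin N → ℕ) :
    alternant N y α * ∑ g ∈ gtPatterns N q, wtMon N y g
      = ∑ g ∈ gtPatterns N q, alternant N y fun r => α r + wt g r := by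
  unfold alternant
  simp only [Matrix.det_apply, Matrix.of_apply]
  rw [sum_mul, sum_comm]
  refine sum_congr rfl fun w _ => ?_
  rw [← sum_wtMon_perm q w y, smul_mul_assoc, mul_sum, ← smul_sum]
  congr 1
  refine sum_congr rfl fun g _ => ?_
  simp only [wtMon, Function.comp_apply, pow_add, prod_mul_distrib]

/-- The pattern `g` satisfies the Littlewood–Richardson condition over the partition `p`:
adding its letters to `p` row by row, from right to left, one always has a partition. -/
def Dominant (p : ℕ → ℕ) (g : ℕ → ℕ → ℕ) : Prop :=
  ∀ i r, p (r + 1) + psum g (r + 2) (i + 1) + psum g r i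
    ≤ p r + psum g (r + 1) i + psum g (r + 1) (i + 1)

end Alternant

/-! ### The sign-reversing involution and the Littlewood–Richardson rule in finitely many variables
-/

section Cancellation

variable {N : ℕ} {p q : ℕ → ℕ} {g : ℕ → ℕ → ℕ} {i r : ℕ}

/-- Failure of the Littlewood–Richardson condition in row `i` for the letters `r`, `r + 1`. -/
def FailsAt (p : ℕ → ℕ) (g : ℕ → ℕ → ℕ) (i r : ℕ) : Prop :=
  p r + psum g (r + 1) i + psum g (r + 1) (i + 1) < p (r + 1) + psum g (r + 2) (i + 1) + psum g r i

theorem dominant_iff : Dominant p g ↔ ∀ i r, ¬ FailsAt p g i r := by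
  simp only [Dominant, FailsAt, not_lt]

/-- The first failure: the topmost row, and in it the largest letter. -/
structure FirstFailure (p : ℕ → ℕ) (g : ℕ → ℕ → ℕ) (i r : ℕ) : Prop where
  fails : FailsAt p g i r
  above : ∀ i' < i, ∀ r', ¬ FailsAt p g i' r'
  larger : ∀ r', r < r' → ¬ FailsAt p g i r'

theorem FirstFailure.unique {i' r' : ℕ} (h : FirstFailure p g i r) (h' : FirstFailure p g i' r') :
    i = i' ∧ r = r' := by
  have hi : i = i' := by
    rcases lt_trichotomy i i' with hlt | heq | hlt
    · exact absurd h.fails (h'.above i hlt r)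
    · exact heq
    · exact absurd h'.fails (h.above i' hlt r')
  subst hi
  refine ⟨rfl, ?_⟩
  rcases lt_trichotomy r r' with hlt | heq | hlt
  · exact absurd h'.fails (h.larger r' hlt)
  · exact heq
  · exact absurd h.fails (h'.larger r hlt)

theorem IsGT.lt_of_failsAt (h : IsGT N q g) (hp : ∀ r, N ≤ r → p r = 0) (hf : FailsAt p g i r) :
    r + 1 < N := by
  by_contra hr
  have h1 : psum g (r + 2) (i + 1) = psum g (r + 1) (i + 1) :=
    sum_congr rfl fun t _ => by rw [h.top (r + 2) t (by omega), h.top (r + 1) t (by omega)]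
  have h2 := h.psum_mono r i
  have h3 := hp (r + 1) (by omega)
  unfold FailsAt at hf
  omega

theorem IsGT.exists_firstFailure (h : IsGT N q g) (hp : ∀ r, N ≤ r → p r = 0)
    (hD : ¬ Dominant p g) : ∃ i r, FirstFailure p g i r := by
  classical
  have hex : ∃ i, ∃ r, FailsAt p g i r := by
    rw [dominant_iff] at hD
    push Not at hD
    exact hD
  obtain ⟨r₀, hr₀⟩ := Nat.find_spec hex
  set i := Nat.find hex with hi
  refine ⟨i, Nat.findGreatest (FailsAt p g i) N, ?_, ?_, ?_⟩
  · have := h.lt_of_failsAt hp hr₀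
    exact Nat.findGreatest_spec (P := FailsAt p g i) (show r₀ ≤ N by omega) hr₀
  · intro i' hi' r' hf
    exact Nat.find_min hex hi' ⟨r', hf⟩
  · intro r' hr' hf
    have := h.lt_of_failsAt hp hf
    exact Nat.findGreatest_is_greatest hr' (by omega) hf

/-- The reflection bound that swaps the letters `r`, `r + 1` after the failure at `(i, r)`. -/
def failBound (p : ℕ → ℕ) (g : ℕ → ℕ → ℕ) (i r : ℕ) : ℕ :=
  p (r + 1) + psum g (r + 2) (i + 1) + psum g r i - p r - 2 * psum g (r + 1) i - 1

/-- Failure is exactly the inequality that makes the natural-number subtraction in `failBound` exact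
and its value at least the current entry. -/
theorem FailsAt.failBound_add (hf : FailsAt p g i r) :
    failBound p g i r + p r + 2 * psum g (r + 1) i + 1
      = p (r + 1) + psum g (r + 2) (i + 1) + psum g r i ∧ g (r + 1) i ≤ failBound p g i r := by
  unfold FailsAt at hf
  rw [psum_succ g (r + 1)] at hf
  unfold failBound
  omega

theorem FirstFailure.toggleable (h : IsGT N q g) (hp : Antitone p)
    (hf : FirstFailure p g i r) : Toggleable g r i (failBound p g i r) := by
  obtain ⟨h1, h2⟩ := hf.fails.failBound_add
  cases i with
  | zero =>
    have := hp (show r ≤ r + 1 by omega)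
    simp only [psum_zero, psum_succ] at h1
    exact ⟨h2, by omega, fun h => absurd h (lt_irrefl _)⟩
  | succ i =>
    -- The condition still holds one row higher for the same letters; combined with the interlacing
    -- inequalities `h4` and `h5` it puts the bound below both neighbouring entries.
    have h3 := hf.above i (Nat.lt_succ_self i) r
    unfold FailsAt at h3
    rw [psum_succ g (r + 2) (i + 1), psum_succ g r i] at h1
    rw [psum_succ g (r + 1) i] at h1 h3
    have h4 := h.mono r i
    have h5 : g (r + 2) (i + 1) ≤ _ := h.inter (r + 1) i
    refine ⟨h2, ?_, fun _ => ?_⟩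
    · omega
    · rw [Nat.add_sub_cancel]; omega

theorem failBound_toggle (C : ℕ) : failBound p (toggle g r i C) i r = failBound p g i r := by
  unfold failBound
  rw [psum_toggle_of_ne (by omega), psum_toggle_of_ne (by omega), psum_toggle_of_le le_rfl]

/-- The toggle changes only level `r + 1` from row `i` on. Rows above see nothing of it, and for a
letter above `r` that level enters the condition in row `i` at most through the rows before `i`;
this is why the largest failing letter is chosen. The failure at `(i, r)` persists because the new
entry is again at most the bound. -/
theorem FirstFailure.firstFailure_toggle (h : IsGT N q g) (hp : Antitone p) (hf : FirstFailure p g i r) :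
    FirstFailure p (toggle g r i (failBound p g i r)) i r := by
  have hT := hf.toggleable h hp
  obtain ⟨h1, h2⟩ := hf.fails.failBound_add
  refine ⟨?_, ?_, ?_⟩
  · have h3 := (h.toggleable_toggle hT).le
    unfold FailsAt
    rw [psum_succ _ (r + 1), psum_toggle_of_ne (s := r + 2) (by omega),
      psum_toggle_of_ne (s := r) (by omega), psum_toggle_of_le le_rfl]
    omega
  · intro i' hi' r' hf'
    apply hf.above i' hi' r'
    unfold FailsAt at hf' ⊢
    rwa [psum_toggle_of_le (by omega), psum_toggle_of_le (by omega), psum_toggle_of_le (by omega),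
      psum_toggle_of_le (by omega)] at hf'
  · intro r' hr' hf'
    apply hf.larger r' hr'
    unfold FailsAt at hf' ⊢
    rwa [psum_toggle_of_ne (by omega), psum_toggle_of_ne (s := r' + 1) (by omega),
      psum_toggle_of_ne (by omega), psum_toggle_of_le le_rfl] at hf'

open Classical in
/-- The sign-reversing involution on the patterns that violate the Littlewood–Richardson
condition. -/
noncomputable def flip (p : ℕ → ℕ) (g : ℕ → ℕ → ℕ) : ℕ → ℕ → ℕ :=
  if h : ∃ c : ℕ × ℕ, FirstFailure p g c.1 c.2 then
    toggle g h.choose.2 h.choose.1 (failBound p g h.choose.1 h.choose.2)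
  else g

theorem FirstFailure.flip_eq (hf : FirstFailure p g i r) :
    flip p g = toggle g r i (failBound p g i r) := by
  have h : ∃ c : ℕ × ℕ, FirstFailure p g c.1 c.2 := ⟨(i, r), hf⟩
  unfold flip
  rw [dif_pos h]
  obtain ⟨h1, h2⟩ := h.choose_spec.unique hf
  rw [h1, h2]

theorem FirstFailure.not_dominant (hf : FirstFailure p g i r) : ¬ Dominant p g := fun h =>
  dominant_iff.1 h i r hf.fails

variable {A : Type*} [CommRing A]

/-- The exponents of the alternant attached to the composition `p + wt g`. -/
def lrExp (N : ℕ) (p : ℕ → ℕ) (g : ℕ → ℕ → ℕ) (r : Fin N) : ℕ := p r + stair N r + wt g r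

theorem FirstFailure.lrExp_flip (h : IsGT N q g) (hp : Antitone p) (hr : r + 1 < N)
    (hf : FirstFailure p g i r) :
    lrExp N p (flip p g) = lrExp N p g ∘ Equiv.swap ⟨r, by omega⟩ ⟨r + 1, hr⟩ := by
  obtain ⟨h1, h2⟩ := hf.fails.failBound_add
  obtain ⟨h3, h4⟩ := h.wt_toggle (hf.toggleable h hp) hr
  rw [hf.flip_eq]
  funext s
  unfold lrExp
  simp only [Function.comp_apply]
  -- This unit step of the staircase is what the `- 1` in `failBound` compensates.
  have hst : stair N r = stair N (r + 1) + 1 := by unfold stair; omega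
  by_cases hs : s = ⟨r, by omega⟩
  · subst hs; rw [Equiv.swap_apply_left]; simp only; omega
  by_cases hs' : s = ⟨r + 1, hr⟩
  · subst hs'; rw [Equiv.swap_apply_right]; simp only; omega
  · rw [Equiv.swap_apply_of_ne_of_ne hs hs', wt_toggle_of_ne]
    · exact fun h => hs (Fin.ext h)
    · exact fun h => hs' (Fin.ext h)

open Classical in
theorem sum_alternant_not_dominant (hp : Antitone p) (hpN : ∀ r, N ≤ r → p r = 0)
    (q : ℕ → ℕ) (y : Fin N → A) :
    ∑ g ∈ gtPatterns N q with ¬ Dominant p g, alternant N y (lrExp N p g) = 0 := by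
  refine sum_involution (fun g _ => flip p g) ?_ ?_ ?_ ?_
  · intro g hg
    obtain ⟨hg, hD⟩ := mem_filter.1 hg
    obtain ⟨i, r, hf⟩ := (mem_gtPatterns.1 hg).exists_firstFailure hpN hD
    have hr := (mem_gtPatterns.1 hg).lt_of_failsAt hpN hf.fails
    rw [hf.lrExp_flip (mem_gtPatterns.1 hg) hp hr, alternant_comp, Equiv.Perm.sign_swap]
    · simp
    · simp
  · intro g hg hne heq
    obtain ⟨hg, hD⟩ := mem_filter.1 hg
    obtain ⟨i, r, hf⟩ := (mem_gtPatterns.1 hg).exists_firstFailure hpN hD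
    have hr := (mem_gtPatterns.1 hg).lt_of_failsAt hpN hf.fails
    have h1 := hf.lrExp_flip (mem_gtPatterns.1 hg) hp hr
    -- A fixed pattern has equal exponents at `r` and `r + 1`, so its alternant already vanishes
    -- through two equal columns.
    rw [heq] at h1
    apply hne
    refine Matrix.det_zero_of_column_eq (i := ⟨r, by omega⟩) (j := ⟨r + 1, hr⟩) (by simp)
      fun s => ?_
    have h2 := congrFun h1 ⟨r, by omega⟩
    rw [Function.comp_apply, Equiv.swap_apply_left] at h2
    simp only [Matrix.of_apply]
    rw [h2]
  · intro g hg
    obtain ⟨hg, hD⟩ := mem_filter.1 hg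
    obtain ⟨i, r, hf⟩ := (mem_gtPatterns.1 hg).exists_firstFailure hpN hD
    have hr := (mem_gtPatterns.1 hg).lt_of_failsAt hpN hf.fails
    have h' := hf.firstFailure_toggle (mem_gtPatterns.1 hg) hp
    rw [hf.flip_eq]
    exact mem_filter.2 ⟨mem_gtPatterns.2 ((mem_gtPatterns.1 hg).isGT_toggle
      (hf.toggleable (mem_gtPatterns.1 hg) hp) hr), h'.not_dominant⟩
  · intro g hg
    obtain ⟨hg, hD⟩ := mem_filter.1 hg
    obtain ⟨i, r, hf⟩ := (mem_gtPatterns.1 hg).exists_firstFailure hpN hD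
    have h' := hf.firstFailure_toggle (mem_gtPatterns.1 hg) hp
    rw [hf.flip_eq, h'.flip_eq, failBound_toggle]
    exact (mem_gtPatterns.1 hg).toggle_toggle (hf.toggleable (mem_gtPatterns.1 hg) hp)

open Classical in
/-- The Littlewood–Richardson patterns with top row `q` over the partition `p`. -/
noncomputable def lrPatterns (N : ℕ) (p q : ℕ → ℕ) : Finset (ℕ → ℕ → ℕ) :=
  {g ∈ gtPatterns N q | Dominant p g}

@[simp] theorem mem_lrPatterns : g ∈ lrPatterns N p q ↔ IsGT N q g ∧ Dominant p g := by
  simp [lrPatterns]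

/-- The Schur polynomial of the partition `q` evaluated at `y`. -/
noncomputable def schurEval (N : ℕ) (y : Fin N → A) (q : ℕ → ℕ) : A :=
  ∑ g ∈ gtPatterns N q, wtMon N y g

theorem alternant_mul_schurEval (hp : Antitone p) (hpN : ∀ r, N ≤ r → p r = 0)
    (q : ℕ → ℕ) (y : Fin N → A) :
    alternant N y (fun r => p r + stair N r) * schurEval N y q
      = ∑ g ∈ lrPatterns N p q, alternant N y (lrExp N p g) := by
  classical
  unfold schurEval lrPatterns
  rw [alternant_mul_sum, ← sum_filter_add_sum_filter_not (gtPatterns N q) (Dominant p)]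
  have := sum_alternant_not_dominant hp hpN q y
  unfold lrExp at this
  rw [this, add_zero]
  rfl

/-- The only Littlewood–Richardson pattern over the empty partition. -/
def superPattern (q : ℕ → ℕ) : ℕ → ℕ → ℕ := fun r i => if i < r then q i else 0

theorem isGT_superPattern (hq : Antitone q) (hqN : ∀ r, N ≤ r → q r = 0) :
    IsGT N q (superPattern q) where
  bot i := by simp [superPattern]
  top r i hr := by
    unfold superPattern
    split_ifs with h
    · rfl
    · rw [hqN i (by omega)]
  mono r i := by
    unfold superPattern
    split_ifs <;> omega
  inter r i := by
    have := hq (show i ≤ i + 1 by omega)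
    unfold superPattern
    split_ifs <;> omega

theorem wt_superPattern (r : ℕ) : wt (superPattern q) r = q r := by
  unfold wt
  rw [psum_succ]
  have h : psum (superPattern q) (r + 1) r = psum (superPattern q) r r :=
    sum_congr rfl fun t ht => by
      have := mem_range.1 ht
      simp [superPattern, this, Nat.lt_succ_of_lt this]
  rw [h, Nat.add_sub_cancel_left]
  simp [superPattern]

/-- Over the empty partition a letter `r + 1` in rows up to `i` must be matched by a letter `r` in
rows before `i`. By induction on rows, the rows before `i` contain no letter beyond their own index,
so neither does row `i`. -/
theorem IsGT.eq_superPattern (h : IsGT N q g) (hD : Dominant 0 g) : g = superPattern q := by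
  have key : ∀ i r, i < r → g (r + 1) i = g r i := by
    intro i
    induction i using Nat.strong_induction_on with
    | _ i ih =>
      intro r hr
      obtain ⟨r, rfl⟩ : ∃ u, r = u + 1 := ⟨r - 1, by omega⟩
      have h1 := hD i r
      have h2 : psum g (r + 2) i = psum g (r + 1) i :=
        sum_congr rfl fun t ht => ih t (mem_range.1 ht) (r + 1) (by have := mem_range.1 ht; omega)
      have h3 : psum g (r + 1) i = psum g r i :=
        sum_congr rfl fun t ht => ih t (mem_range.1 ht) r (by have := mem_range.1 ht; omega)
      have h4 := h.mono (r + 1) i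
      simp only [psum_succ, Pi.zero_apply] at h1
      have : g (r + 2) i = g (r + 1 + 1) i := rfl
      omega
  funext r i
  unfold superPattern
  split_ifs with hi
  · have : ∀ m, g (r + m) i = g r i := by
      intro m
      induction m with
      | zero => rfl
      | succ m ih => rw [← add_assoc, key i (r + m) (by omega), ih]
    rw [← this N, h.top _ _ (by omega)]
  · exact h.eq_zero r i (by omega)

theorem dominant_superPattern (hq : Antitone q) : Dominant 0 (superPattern q) := by
  intro i r
  have h1 := hq (show r ≤ r + 1 by omega)
  have key : ∀ s m, psum (superPattern q) s m = ∑ t ∈ range (min m s), q t := by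
    intro s m
    induction m with
    | zero => simp
    | succ m ih =>
      rw [psum_succ, ih, superPattern]
      split_ifs with h
      · rw [min_eq_left (by omega), min_eq_left (by omega), sum_range_succ]
      · rw [min_eq_right (by omega), min_eq_right (by omega), add_zero]
  simp only [key, Pi.zero_apply]
  by_cases hi : i < r
  · rw [min_eq_left (show i ≤ r by omega), min_eq_left (show i ≤ r + 1 by omega),
      min_eq_left (show i + 1 ≤ r + 1 by omega), min_eq_left (show i + 1 ≤ r + 2 by omega)]
    omega
  by_cases hi' : i = r
  · subst hi'
    rw [min_eq_left (show i ≤ i by omega), min_eq_left (show i ≤ i + 1 by omega),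
      min_eq_left (show i + 1 ≤ i + 1 by omega), min_eq_left (show i + 1 ≤ i + 2 by omega)]
    omega
  · rw [min_eq_right (show r ≤ i by omega), min_eq_right (show r + 1 ≤ i by omega),
      min_eq_right (show r + 1 ≤ i + 1 by omega), min_eq_right (show r + 2 ≤ i + 1 by omega),
      sum_range_succ _ (r + 1), sum_range_succ _ r]
    omega

/-- The bialternant formula is the case of the empty partition, where a single pattern survives the
cancellation. -/
theorem alternant_stair_mul_schurEval (hq : Antitone q) (hqN : ∀ r, N ≤ r → q r = 0)
    (y : Fin N → A) :
    alternant N y (fun r => stair N r) * schurEval N y q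
      = alternant N y fun r => q r + stair N r := by
  have h := alternant_mul_schurEval (N := N) (p := 0) (fun _ _ _ => le_rfl) (fun _ _ => rfl) q y
  have hs : lrPatterns N 0 q = {superPattern q} := by
    ext g
    rw [mem_lrPatterns, mem_singleton]
    exact ⟨fun h => h.1.eq_superPattern h.2, fun h =>
      h ▸ ⟨isGT_superPattern hq hqN, dominant_superPattern hq⟩⟩
  rw [hs, sum_singleton] at h
  simp only [Pi.zero_apply, zero_add] at h
  rw [h]
  congr 1
  funext r
  simp only [lrExp, Pi.zero_apply, wt_superPattern]
  omega

theorem alternant_stair_ne_zero [IsDomain A] {y : Fin N → A} (hy : Function.Injective y) :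
    alternant N y (fun r => stair N r) ≠ 0 := by
  have h1 : (fun r : Fin N => stair N r) = (fun j : Fin N => (j : ℕ)) ∘ Fin.revPerm := by
    funext r
    simp only [stair, Function.comp_apply, Fin.revPerm_apply, Fin.val_rev]
    omega
  rw [h1, alternant_comp]
  have h2 : alternant N y (fun j : Fin N => (j : ℕ)) = (Matrix.vandermonde y).det := rfl
  rw [h2]
  refine mul_ne_zero ?_ (Matrix.det_vandermonde_ne_zero_iff.2 hy)
  rcases Int.units_eq_one_or (Equiv.Perm.sign (Fin.revPerm (n := N))) with h | h <;> simp [h]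

/-- The partition obtained from `p` by adding the weight of `g`. -/
def addWt (p : ℕ → ℕ) (g : ℕ → ℕ → ℕ) (r : ℕ) : ℕ := p r + wt g r

theorem IsGT.antitone_addWt (h : IsGT N q g) (hD : Dominant p g) : Antitone (addWt p g) := by
  refine antitone_nat_of_succ_le fun r => ?_
  -- Row `r + 2` is far enough down that every partial sum involved is the full size of its level,
  -- so the condition compares the final parts.
  have h1 := hD (r + 2) r
  have h2 := h.wt_add_of_le (show r < r + 2 by omega)
  have h3 : wt g (r + 1) + psum g (r + 1) (r + 2 + 1) = psum g (r + 2) (r + 2 + 1) :=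
    h.wt_add_of_le (show r + 1 < r + 2 + 1 by omega)
  unfold addWt
  omega

theorem IsGT.addWt_eq_zero (h : IsGT N q g) (hpN : ∀ r, N ≤ r → p r = 0) {r : ℕ} (hr : N ≤ r) :
    addWt p g r = 0 := by
  rw [addWt, hpN r hr, h.wt_eq_zero hr]

/-- The Littlewood–Richardson rule for Schur polynomials in `N` variables. -/
theorem schurEval_mul [IsDomain A] {y : Fin N → A} (hy : Function.Injective y)
    (hp : Antitone p) (hpN : ∀ r, N ≤ r → p r = 0) (q : ℕ → ℕ) :
    schurEval N y p * schurEval N y q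
      = ∑ g ∈ lrPatterns N p q, schurEval N y (addWt p g) := by
  -- After multiplication by the Vandermonde alternant both sides are the same sum of alternants.
  apply mul_left_cancel₀ (alternant_stair_ne_zero hy)
  rw [← mul_assoc, alternant_stair_mul_schurEval hp hpN, alternant_mul_schurEval hp hpN, mul_sum]
  refine sum_congr rfl fun g hg => ?_
  obtain ⟨hg, hD⟩ := mem_lrPatterns.1 hg
  rw [alternant_stair_mul_schurEval (hg.antitone_addWt hD) fun r hr => hg.addWt_eq_zero hpN hr]
  congr 1
  funext r
  simp only [lrExp, addWt]
  omega

/-- A Littlewood–Richardson pattern only uses letters below the total number of rows. -/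
theorem IsGT.of_dominant (h : IsGT N q g) (hD : Dominant p g) {a b : ℕ}
    (hp : ∀ r, a ≤ r → p r = 0) (hq : ∀ r, b ≤ r → q r = 0) : IsGT (a + b) q g := by
  have key : ∀ t i, i ≤ t → psum g (a + t + 1) i = psum g (a + t) i := by
    intro t
    induction t with
    | zero => intro i hi; obtain rfl : i = 0 := by omega
              rfl
    | succ t ih =>
      intro i hi
      cases i with
      | zero => rfl
      | succ i =>
        have h1 := hD i (a + t)
        have h2 := ih i (by omega)
        have h3 := h.psum_mono (a + t + 1) (i + 1)
        rw [hp _ (by omega), hp _ (by omega)] at h1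
        have e : a + (t + 1) = a + t + 1 := by omega
        rw [e]
        have e' : psum g (a + t + 1 + 1) (i + 1) = psum g (a + t + 2) (i + 1) := rfl
        omega
  have step : ∀ r i, a + b ≤ r → g (r + 1) i = g r i := by
    intro r i hr
    by_cases hi : i < b
    · obtain ⟨t, rfl⟩ : ∃ t, r = a + t := ⟨r - a, by omega⟩
      have h1 := key t (i + 1) (by omega)
      have h2 := key t i (by omega)
      rw [psum_succ, psum_succ] at h1
      omega
    · have h1 := h.le_top (r + 1) i
      have h2 := h.mono r i
      rw [hq i (by omega)] at h1
      omega
  refine ⟨h.bot, fun r i hr => ?_, h.mono, h.inter⟩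
  have : ∀ m, g (r + m) i = g r i := by
    intro m
    induction m with
    | zero => rfl
    | succ m ih => rw [← add_assoc, step _ _ (by omega), ih]
  rw [← this N, h.top _ _ (by omega)]

theorem IsGT.of_le (h : IsGT N q g) {M : ℕ} (hM : N ≤ M) : IsGT M q g :=
  ⟨h.bot, fun r i hr => h.top r i (hM.trans hr), h.mono, h.inter⟩

/-- Stability in the number of variables: this lets the identities for Schur polynomials be
assembled into one for Schur functions. -/
theorem lrPatterns_eq {a b : ℕ} (hp : ∀ r, a ≤ r → p r = 0) (hq : ∀ r, b ≤ r → q r = 0)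
    (hN : a + b ≤ N) : lrPatterns N p q = lrPatterns (a + b) p q := by
  ext g
  rw [mem_lrPatterns, mem_lrPatterns]
  exact ⟨fun h => ⟨h.1.of_dominant h.2 hp hq, h.2⟩, fun h => ⟨h.1.of_le hN, h.2⟩⟩

end Cancellation

/-! ### Tableaux and patterns -/

/-- An initial segment of ℕ is determined by its size; applied to the entries below `r` in a weakly
increasing row. -/
theorem mem_iff_lt_card {S : Finset ℕ} (hS : ∀ a ∈ S, ∀ b < a, b ∈ S) {j : ℕ} :
    j ∈ S ↔ j < #S := by
  constructor
  · intro hj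
    have : range (j + 1) ⊆ S := fun b hb => by
      rcases Nat.lt_succ_iff_lt_or_eq.1 (mem_range.1 hb) with h | h
      · exact hS j hj b h
      · exact h ▸ hj
    simpa using card_le_card this
  · intro hj
    by_contra h
    have : S ⊆ range j := fun b hb => by
      rw [mem_range]
      by_contra hb'
      rcases (not_lt.1 hb').eq_or_lt with h' | h'
      · exact h (h' ▸ hb)
      · exact h (hS b hb j h')
    have := card_le_card this
    rw [card_range] at this
    omega

section Tableaux

variable {μ : YoungDiagram}

/-- The pattern of a tableau. -/
def levels (T : SemistandardYoungTableau μ) (r i : ℕ) : ℕ :=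
  #{j ∈ range (μ.rowLen i) | T i j < r}

theorem lt_levels (T : SemistandardYoungTableau μ) {r i j : ℕ} :
    j < levels T r i ↔ (i, j) ∈ μ ∧ T i j < r := by
  unfold levels
  rw [← mem_iff_lt_card]
  · rw [mem_filter, mem_range, YoungDiagram.mem_iff_lt_rowLen]
  · intro a ha b hb
    rw [mem_filter, mem_range] at ha ⊢
    refine ⟨by omega, ?_⟩
    have := T.row_weak hb (YoungDiagram.mem_iff_lt_rowLen.2 ha.1)
    omega

theorem content_apply (T : SemistandardYoungTableau μ) (r : ℕ) :
    content T r = #{c ∈ μ.cells | T c.1 c.2 = r} := by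
  unfold content
  rw [Finsupp.finsetSum_apply, card_filter]
  exact sum_congr rfl fun c _ => by rw [Finsupp.single_apply]

theorem lt_of_content (T : SemistandardYoungTableau μ) {N : ℕ}
    (hN : ∀ r ∈ (content T).support, r < N) {i j : ℕ} (h : (i, j) ∈ μ) : T i j < N := by
  apply hN
  rw [Finsupp.mem_support_iff, content_apply, ← Nat.pos_iff_ne_zero, card_pos]
  exact ⟨(i, j), mem_filter.2 ⟨h, rfl⟩⟩

theorem isGT_levels (T : SemistandardYoungTableau μ) {N : ℕ}
    (hN : ∀ i j, (i, j) ∈ μ → T i j < N) : IsGT N μ.rowLen (levels T) where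
  bot i := by simp [levels]
  top r i hr := by
    unfold levels
    rw [filter_true_of_mem, card_range]
    intro j hj
    have := hN i j (YoungDiagram.mem_iff_lt_rowLen.2 (mem_range.1 hj))
    omega
  mono r i := card_le_card (monotone_filter_right _ fun j _ h => Nat.lt_succ_of_lt h)
  inter r i := by
    apply card_le_card
    intro j hj
    rw [mem_filter, mem_range] at hj ⊢
    have h1 := μ.rowLen_anti i (i + 1) (Nat.le_succ i)
    have h2 := T.col_strict (show i < i + 1 by omega) (YoungDiagram.mem_iff_lt_rowLen.2 hj.1)
    exact ⟨by omega, by omega⟩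

theorem psum_levels (T : SemistandardYoungTableau μ) (r : ℕ) {M : ℕ} (hM : μ.colLen 0 ≤ M) :
    psum (levels T) r M = #{c ∈ μ.cells | T c.1 c.2 < r} := by
  rw [card_eq_sum_card_fiberwise (f := Prod.fst) (t := range M)]
  · refine sum_congr rfl fun i _ => ?_
    refine card_bij (fun j _ => (i, j)) ?_ ?_ ?_
    · intro j hj
      rw [mem_filter, mem_range] at hj
      exact mem_filter.2 ⟨mem_filter.2 ⟨YoungDiagram.mem_iff_lt_rowLen.2 hj.1, hj.2⟩, rfl⟩
    · intro j _ j' _ h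
      exact (Prod.mk.inj h).2
    · rintro ⟨i', j⟩ hc
      simp only [mem_filter] at hc
      obtain ⟨⟨h1, h2⟩, rfl⟩ := hc
      exact ⟨j, mem_filter.2 ⟨mem_range.2 (YoungDiagram.mem_iff_lt_rowLen.1 h1), h2⟩, rfl⟩
  · rintro ⟨i, j⟩ hc
    have h1 : (i, j) ∈ μ := (mem_filter.1 hc).1
    have h2 := YoungDiagram.mem_iff_lt_colLen.1 h1
    have h3 := μ.colLen_anti 0 j (Nat.zero_le _)
    simp only [coe_range, Set.mem_Iio]
    omega

theorem wt_levels (T : SemistandardYoungTableau μ) {N : ℕ}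
    (hN : ∀ i j, (i, j) ∈ μ → T i j < N) (r : ℕ) : wt (levels T) r = content T r := by
  have h := (isGT_levels T hN).wt_add_of_le (show r < max (r + 1) (μ.colLen 0) by omega)
  rw [psum_levels T _ (le_max_right _ _), psum_levels T _ (le_max_right _ _)] at h
  rw [content_apply]
  have h2 : ({c ∈ μ.cells | T c.1 c.2 < r + 1} : Finset (ℕ × ℕ))
      = {c ∈ μ.cells | T c.1 c.2 = r} ∪ {c ∈ μ.cells | T c.1 c.2 < r} := by
    ext c
    simp only [mem_filter, mem_union]
    constructor
    · rintro ⟨h1, h2⟩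
      rcases Nat.lt_succ_iff_lt_or_eq.1 h2 with h | h
      · exact Or.inr ⟨h1, h⟩
      · exact Or.inl ⟨h1, h⟩
    · rintro (⟨h1, h2⟩ | ⟨h1, h2⟩)
      · exact ⟨h1, by omega⟩
      · exact ⟨h1, by omega⟩
  rw [h2, card_union_of_disjoint] at h
  · omega
  · rw [disjoint_filter]
    intro c _ h1 h2
    omega

theorem levels_injective : Function.Injective (levels (μ := μ)) := by
  intro T T' h
  apply SemistandardYoungTableau.ext
  intro i j
  by_cases hc : (i, j) ∈ μ
  · have key : ∀ r, T i j < r ↔ T' i j < r := fun r => by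
      have h1 := lt_levels T (r := r) (i := i) (j := j)
      rw [h, lt_levels] at h1
      simpa [hc] using h1.symm
    have h1 := (key (T i j + 1)).1 (Nat.lt_succ_self _)
    have h2 := (key (T' i j + 1)).2 (Nat.lt_succ_self _)
    omega
  · rw [T.zeros hc, T'.zeros hc]

/-- The infimum is the entry in cell `(i, j)` of the tableau to be built; through this equivalence
the tableau axioms become the monotonicity and interlacing of the pattern. -/
theorem sInf_lt_iff_of_mono {N : ℕ} {q : ℕ → ℕ} {g : ℕ → ℕ → ℕ} (h : IsGT N q g) {i j : ℕ}
    (hj : j < q i) (r : ℕ) : sInf {s | j < g (s + 1) i} < r ↔ j < g r i := by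
  have hne : {s | j < g (s + 1) i}.Nonempty :=
    ⟨N, by rw [Set.mem_ofPred_eq, h.top _ _ (Nat.le_succ N)]; exact hj⟩
  constructor
  · intro hr
    have h1 : j < g (sInf {s | j < g (s + 1) i} + 1) i := Nat.sInf_mem hne
    exact h1.trans_le (h.mono_le i hr)
  · intro hr
    cases r with
    | zero => rw [h.bot] at hr; omega
    | succ r => exact Nat.lt_succ_of_le (Nat.sInf_le hr)

/-- The tableau of a pattern. -/
noncomputable def tableauOfLevels {N : ℕ} {g : ℕ → ℕ → ℕ} (h : IsGT N μ.rowLen g) :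
    SemistandardYoungTableau μ where
  entry i j := sInf {s | j < g (s + 1) i}
  row_weak' := by
    intro i j1 j2 hj hc
    have h2 := YoungDiagram.mem_iff_lt_rowLen.1 hc
    apply Nat.le_of_lt_succ
    rw [sInf_lt_iff_of_mono h (by omega)]
    refine hj.trans ?_
    rw [← sInf_lt_iff_of_mono h h2]
    exact Nat.lt_succ_self _
  col_strict' := by
    intro i1 i2 j hi hc
    have h2 := YoungDiagram.mem_iff_lt_rowLen.1 hc
    have h1 := μ.rowLen_anti i1 i2 hi.le
    rw [sInf_lt_iff_of_mono h (by omega)]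
    have h3 : j < g (sInf {s | j < g (s + 1) i2} + 1) i2 := by
      rw [← sInf_lt_iff_of_mono h h2]
      exact Nat.lt_succ_self _
    exact h3.trans_le ((h.anti _ hi).trans (h.inter _ _))
  zeros' := by
    intro i j hc
    have : {s | j < g (s + 1) i} = ∅ := by
      ext s
      simp only [Set.mem_ofPred_eq, Set.mem_empty_iff_false, iff_false]
      intro hs
      exact hc (YoungDiagram.mem_iff_lt_rowLen.2 (hs.trans_le (h.le_top _ _)))
    rw [this, Nat.sInf_empty]

theorem tableauOfLevels_lt {N : ℕ} {g : ℕ → ℕ → ℕ} (h : IsGT N μ.rowLen g) {i j r : ℕ}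
    (hc : (i, j) ∈ μ) : tableauOfLevels h i j < r ↔ j < g r i :=
  sInf_lt_iff_of_mono h (YoungDiagram.mem_iff_lt_rowLen.1 hc) r

theorem levels_tableauOfLevels {N : ℕ} {g : ℕ → ℕ → ℕ} (h : IsGT N μ.rowLen g) :
    levels (tableauOfLevels h) = g := by
  funext r i
  apply eq_of_forall_lt_iff
  intro j
  rw [lt_levels]
  constructor
  · rintro ⟨h1, h2⟩
    exact (tableauOfLevels_lt h h1).1 h2
  · intro h1
    have hc : (i, j) ∈ μ := YoungDiagram.mem_iff_lt_rowLen.2 (h1.trans_le (h.le_top _ _))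
    exact ⟨hc, (tableauOfLevels_lt h hc).2 h1⟩

-- The assignment of levels is a bijection onto patterns of the given weight. Bounding the support
-- of `d` by `N` bounds all letters, so `N` levels suffice.
open Classical in
theorem card_content_eq {N : ℕ} {d : ℕ →₀ ℕ} (hd : ∀ r ∈ d.support, r < N) :
    Nat.card {T : SemistandardYoungTableau μ // content T = d}
      = #{g ∈ gtPatterns N μ.rowLen | ∀ r, d r = wt g r} := by
  rw [← Fintype.card_coe, ← Nat.card_eq_fintype_card]
  have hlt : ∀ T : SemistandardYoungTableau μ, content T = d → ∀ i j, (i, j) ∈ μ → T i j < N := by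
    rintro T rfl i j hc
    exact lt_of_content T hd hc
  refine Nat.card_congr (Equiv.ofBijective (fun T => ⟨levels T.1, mem_filter.2
    ⟨mem_gtPatterns.2 (isGT_levels T.1 (hlt T.1 T.2)), fun r => ?_⟩⟩) ⟨?_, ?_⟩)
  · rw [wt_levels T.1 (hlt T.1 T.2), T.2]
  · intro T T' h
    exact Subtype.ext (levels_injective (congrArg Subtype.val h))
  · rintro ⟨g, hg⟩
    rw [mem_filter, mem_gtPatterns] at hg
    have h := levels_tableauOfLevels hg.1
    refine ⟨⟨tableauOfLevels hg.1, ?_⟩, Subtype.ext h⟩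
    ext r
    rw [hg.2 r]
    have hN : ∀ i j, (i, j) ∈ μ → tableauOfLevels hg.1 i j < N := fun i j hc => by
      rw [tableauOfLevels_lt hg.1 hc, hg.1.top _ _ le_rfl]
      exact YoungDiagram.mem_iff_lt_rowLen.1 hc
    rw [← wt_levels _ hN, h]

end Tableaux

/-! ### Truncation to finitely many variables -/

open Classical in
/-- Setting the variables `x_N, x_{N+1}, …` to zero. -/
noncomputable def trunc (N : ℕ) : MvPowerSeries ℕ ℚ →+ MvPowerSeries ℕ ℚ where
  toFun f := fun d => if ∀ r ∈ d.support, r < N then MvPowerSeries.coeff d f else 0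
  map_zero' := by
    funext d
    simp only [map_zero, ite_self]
    rfl
  map_add' f f' := by
    funext d
    change (if ∀ r ∈ d.support, r < N then MvPowerSeries.coeff d (f + f') else 0)
      = (if ∀ r ∈ d.support, r < N then MvPowerSeries.coeff d f else 0)
        + (if ∀ r ∈ d.support, r < N then MvPowerSeries.coeff d f' else 0)
    split_ifs
    · rw [map_add]
    · rw [add_zero]

open Classical in
theorem coeff_trunc (N : ℕ) (f : MvPowerSeries ℕ ℚ) (d : ℕ →₀ ℕ) :
    MvPowerSeries.coeff d (trunc N f)
      = if ∀ r ∈ d.support, r < N then MvPowerSeries.coeff d f else 0 := rfl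

theorem trunc_mul (N : ℕ) (f f' : MvPowerSeries ℕ ℚ) :
    trunc N (f * f') = trunc N f * trunc N f' := by
  classical
  ext d
  rw [coeff_trunc, MvPowerSeries.coeff_mul, MvPowerSeries.coeff_mul]
  split_ifs with h
  · refine sum_congr rfl fun c hc => ?_
    have hc' := mem_antidiagonal.1 hc
    rw [coeff_trunc, coeff_trunc, if_pos, if_pos]
    · intro r hr
      apply h
      rw [Finsupp.mem_support_iff] at hr ⊢
      rw [← hc', Finsupp.add_apply]
      omega
    · intro r hr
      apply h
      rw [Finsupp.mem_support_iff] at hr ⊢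
      rw [← hc', Finsupp.add_apply]
      omega
  -- If the monomial involves a variable that is set to zero, then so does one of its two factors in
  -- every decomposition.
  · symm
    refine sum_eq_zero fun c hc => ?_
    have hc' := mem_antidiagonal.1 hc
    rw [coeff_trunc, coeff_trunc]
    split_ifs with h1 h2 h2
    · exfalso
      apply h
      intro r hr
      rw [Finsupp.mem_support_iff, ← hc', Finsupp.add_apply] at hr
      by_cases h3 : c.1 r = 0
      · exact h2 r (Finsupp.mem_support_iff.2 (by omega))
      · exact h1 r (Finsupp.mem_support_iff.2 h3)
    all_goals simp

theorem eq_of_trunc_eq {f f' : MvPowerSeries ℕ ℚ} (N₀ : ℕ)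
    (h : ∀ N, N₀ ≤ N → trunc N f = trunc N f') : f = f' := by
  classical
  ext d
  have hd : ∀ r ∈ d.support, r < max N₀ (d.support.sup id + 1) := fun r hr => by
    have : r ≤ d.support.sup id := le_sup (f := id) hr
    omega
  have h1 := congrArg (MvPowerSeries.coeff d) (h (max N₀ (d.support.sup id + 1)) (le_max_left _ _))
  rwa [coeff_trunc, coeff_trunc, if_pos hd, if_pos hd] at h1

theorem prod_X_pow_eq_monomial {ι : Type*} (s : Finset ι) (v : ι → ℕ) (f : ι → ℕ) :
    ∏ i ∈ s, (MvPowerSeries.X (v i) : MvPowerSeries ℕ ℚ) ^ f i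
      = MvPowerSeries.monomial (∑ i ∈ s, Finsupp.single (v i) (f i)) 1 := by
  classical
  induction s using Finset.induction_on with
  | empty => simp
  | insert a s ha ih =>
    rw [prod_insert ha, sum_insert ha, ih, MvPowerSeries.X_pow_eq,
      MvPowerSeries.monomial_mul_monomial, one_mul]

theorem IsGT.sum_single_wt {N : ℕ} {q : ℕ → ℕ} {g : ℕ → ℕ → ℕ} (h : IsGT N q g) (r : ℕ) :
    (∑ s : Fin N, Finsupp.single (s : ℕ) (wt g s)) r = wt g r := by
  rw [Finsupp.finsetSum_apply]
  by_cases hr : r < N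
  · rw [Fintype.sum_eq_single ⟨r, hr⟩, Finsupp.single_eq_same]
    intro s hs
    rw [Finsupp.single_apply, if_neg]
    exact fun h => hs (Fin.ext h)
  · rw [h.wt_eq_zero (by omega)]
    refine sum_eq_zero fun s _ => ?_
    rw [Finsupp.single_apply, if_neg]
    have := s.2
    omega

/-- A Schur function in the first `N` variables is the corresponding Schur polynomial. -/
theorem trunc_schur (N : ℕ) (μ : YoungDiagram) :
    trunc N (schur μ)
      = schurEval N (fun r : Fin N => (MvPowerSeries.X (r : ℕ) : MvPowerSeries ℕ ℚ)) μ.rowLen := by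
  classical
  ext d
  rw [coeff_trunc, schurEval, map_sum]
  have h1 : ∀ g ∈ gtPatterns N μ.rowLen, MvPowerSeries.coeff d
      (wtMon N (fun r : Fin N => (MvPowerSeries.X (r : ℕ) : MvPowerSeries ℕ ℚ)) g)
        = if ∀ r, d r = wt g r then 1 else 0 := fun g hg => by
    rw [wtMon, prod_X_pow_eq_monomial, MvPowerSeries.coeff_monomial]
    congr 1
    rw [Finsupp.ext_iff]
    simp only [(mem_gtPatterns.1 hg).sum_single_wt]
  rw [sum_congr rfl h1, sum_boole]
  split_ifs with hd
  · rw [← card_content_eq hd]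
    rfl
  · rw [filter_false_of_mem]
    · simp
    · intro g hg h
      apply hd
      intro r hr
      by_contra hrN
      rw [Finsupp.mem_support_iff, h r, (mem_gtPatterns.1 hg).wt_eq_zero (by omega)] at hr
      exact hr rfl

/-! ### The Littlewood–Richardson rule for Schur functions -/

open Classical in
/-- The Young diagram with given row lengths (empty if these do not form a partition). -/
noncomputable def ofRows (f : ℕ → ℕ) : YoungDiagram :=
  if h : Antitone f ∧ ∃ N, ∀ r, N ≤ r → f r = 0 then
    { cells := {c ∈ range h.2.choose ×ˢ range (f 0) | c.2 < f c.1}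
      isLowerSet := by
        rintro ⟨i, j⟩ ⟨i', j'⟩ hle hc
        have h1 : i' ≤ i := hle.1
        have h2 : j' ≤ j := hle.2
        have h3 := h.1 h1
        simp only [coe_filter, mem_product, mem_range, Set.mem_ofPred_eq] at hc ⊢
        omega }
  else ⊥

theorem rowLen_ofRows {f : ℕ → ℕ} (hf : Antitone f) {N : ℕ} (hN : ∀ r, N ≤ r → f r = 0) :
    (ofRows f).rowLen = f := by
  have h : Antitone f ∧ ∃ N, ∀ r, N ≤ r → f r = 0 := ⟨hf, N, hN⟩
  funext i
  apply eq_of_forall_lt_iff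
  intro j
  rw [← YoungDiagram.mem_iff_lt_rowLen, ofRows, dif_pos h, ← YoungDiagram.mem_cells]
  simp only [mem_filter, mem_product, mem_range]
  refine ⟨fun h => h.2, fun hj => ⟨⟨?_, hj.trans_le (hf (Nat.zero_le i))⟩, hj⟩⟩
  by_contra hi
  have h1 := h.2.choose_spec i (not_lt.1 hi)
  omega

theorem diagram_ext {μ ν : YoungDiagram} (h : ∀ i, μ.rowLen i = ν.rowLen i) : μ = ν := by
  apply YoungDiagram.ext
  ext ⟨i, j⟩
  rw [YoungDiagram.mem_cells, YoungDiagram.mem_cells, YoungDiagram.mem_iff_lt_rowLen,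
    YoungDiagram.mem_iff_lt_rowLen, h]

theorem ofRows_rowLen (μ : YoungDiagram) : ofRows μ.rowLen = μ :=
  diagram_ext fun i => by
    rw [rowLen_ofRows (fun a b h => μ.rowLen_anti a b h) (N := μ.colLen 0)]
    intro r hr
    by_contra h
    have := YoungDiagram.mem_iff_lt_colLen.1
      (YoungDiagram.mem_iff_lt_rowLen.2 (Nat.pos_of_ne_zero h))
    omega

theorem rowLen_antitone (μ : YoungDiagram) : Antitone μ.rowLen := fun a b h => μ.rowLen_anti a b h

theorem rowLen_eq_zero {μ : YoungDiagram} {r : ℕ} (hr : μ.colLen 0 ≤ r) : μ.rowLen r = 0 := by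
  by_contra h
  have := YoungDiagram.mem_iff_lt_colLen.1
    (YoungDiagram.mem_iff_lt_rowLen.2 (Nat.pos_of_ne_zero h))
  omega

theorem rowLen_addWt {N : ℕ} {P Q : YoungDiagram} {g : ℕ → ℕ → ℕ}
    (hg : g ∈ lrPatterns N P.rowLen Q.rowLen) :
    (ofRows (addWt P.rowLen g)).rowLen = addWt P.rowLen g := by
  obtain ⟨h1, h2⟩ := mem_lrPatterns.1 hg
  refine rowLen_ofRows (h1.antitone_addWt h2) (N := max N (P.colLen 0)) fun r hr => ?_
  exact (h1.of_le (le_max_left _ _)).addWt_eq_zero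
    (fun s hs => rowLen_eq_zero (by omega)) hr

/-- The Littlewood–Richardson rule. -/
theorem schur_mul (P Q : YoungDiagram) {N : ℕ} (hN : P.colLen 0 + Q.colLen 0 ≤ N) :
    schur P * schur Q
      = ∑ g ∈ lrPatterns N P.rowLen Q.rowLen, schur (ofRows (addWt P.rowLen g)) := by
  have hP : ∀ r, P.colLen 0 ≤ r → P.rowLen r = 0 := fun r hr => rowLen_eq_zero hr
  have hQ : ∀ r, Q.colLen 0 ≤ r → Q.rowLen r = 0 := fun r hr => rowLen_eq_zero hr
  apply eq_of_trunc_eq N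
  intro M hM
  have : IsDomain (MvPowerSeries ℕ ℚ) := NoZeroDivisors.to_isDomain _
  -- In `M` variables the rule sums over patterns with `M` levels; by stability these are the
  -- patterns with `N` levels, independently of `M`.
  rw [trunc_mul, map_sum, trunc_schur, trunc_schur, schurEval_mul _ (rowLen_antitone P)
    (fun r hr => hP r (by omega)), lrPatterns_eq hP hQ (by omega), ← lrPatterns_eq hP hQ hN]
  · refine sum_congr rfl fun g hg => ?_
    rw [trunc_schur, rowLen_addWt hg]
  · intro a b hab
    exact Fin.ext (MvPowerSeries.X_inj.1 hab)

/-! ### Schur positivity and lengthening the first row -/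

theorem schurPositive_sum {ι : Type*} (s : Finset ι) (f : ι → YoungDiagram) :
    SchurPositive (∑ a ∈ s, schur (f a)) := by
  classical
  refine ⟨∑ a ∈ s, Finsupp.single (f a) 1, fun ν => ?_, ?_⟩
  · rw [Finsupp.finsetSum_apply]
    refine sum_nonneg fun a _ => ?_
    rw [Finsupp.single_apply]
    split_ifs <;> norm_num
  · rw [← Finsupp.sum_finsetSum_index (by simp) (by intros; rw [add_smul])]
    refine sum_congr rfl fun a _ => ?_
    rw [Finsupp.sum_single_index (by simp), one_smul]

theorem SchurPositive.add {f f' : MvPowerSeries ℕ ℚ} (h : SchurPositive f)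
    (h' : SchurPositive f') : SchurPositive (f + f') := by
  classical
  obtain ⟨c, hc, rfl⟩ := h
  obtain ⟨c', hc', rfl⟩ := h'
  refine ⟨c + c', fun ν => add_nonneg (hc ν) (hc' ν), ?_⟩
  rw [Finsupp.sum_add_index' (by simp) (by intros; rw [add_smul])]

theorem schurPositive_zero : SchurPositive 0 :=
  ⟨0, fun _ => le_rfl, by simp⟩

/-- Prepending `k` letters `0` to the first row. -/
def prepend (k : ℕ) (g : ℕ → ℕ → ℕ) : ℕ → ℕ → ℕ := fun r i =>
  if i = 0 ∧ 0 < r then g r i + k else g r i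

section Prepend

variable {N k : ℕ} {p p' q q' : ℕ → ℕ} {g : ℕ → ℕ → ℕ}

theorem prepend_injective (k : ℕ) : Function.Injective (prepend k) := by
  intro g g' h
  funext r i
  have h1 := congrFun (congrFun h r) i
  unfold prepend at h1
  split_ifs at h1 <;> omega

theorem isGT_prepend (h : IsGT N q g) (hN : 0 < N) (h0 : q' 0 = q 0 + k)
    (hs : ∀ i, q' (i + 1) = q (i + 1)) : IsGT N q' (prepend k g) where
  bot i := by simp [prepend, h.bot]
  top r i hr := by
    cases i with
    | zero => rw [prepend, if_pos ⟨rfl, by omega⟩, h.top r 0 hr, h0]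
    | succ i => rw [prepend, if_neg (by omega), h.top r _ hr, hs]
  mono r i := by
    have := h.mono r i
    unfold prepend
    split_ifs <;> omega
  inter r i := by
    have := h.inter r i
    rw [prepend, prepend, if_neg (by omega)]
    split_ifs <;> omega

theorem psum_prepend (r i : ℕ) :
    psum (prepend k g) r i = psum g r i + if 0 < i ∧ 0 < r then k else 0 := by
  induction i with
  | zero => simp
  | succ i ih =>
    rw [psum_succ, psum_succ, ih, prepend]
    split_ifs <;> omega

theorem wt_prepend (h : IsGT N q g) (r : ℕ) :
    wt (prepend k g) r = wt g r + if r = 0 then k else 0 := by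
  have h1 := h.wt_add r
  unfold wt at h1 ⊢
  rw [psum_prepend, psum_prepend]
  split_ifs <;> omega

/-- The `k` zeros replace the `k` cells missing from `p' 0` in every condition that counts zeros of
the first row. Only the condition for the letters 0, 1 in row 0 does not count them yet, and there
`hq` suffices, since `g 2 0 ≤ q 0`. -/
theorem dominant_prepend (h : IsGT N q g) (hD : Dominant p g) (h0 : p 0 = p' 0 + k)
    (hs : ∀ i, p (i + 1) = p' (i + 1)) (hq : p' 1 + q 0 ≤ p' 0) :
    Dominant p' (prepend k g) := by
  intro i r
  have h1 := hD i r
  rw [hs] at h1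
  simp only [psum_prepend]
  cases r with
  | zero =>
    cases i with
    | zero =>
      have h2 := h.le_top 2 0
      simp only [psum_succ, psum_zero]
      simp only [zero_add] at *
      split_ifs <;> omega
    | succ i =>
      rw [h0] at h1
      split_ifs <;> omega
  | succ r =>
    rw [hs] at h1
    split_ifs <;> omega

end Prepend

/-- Moving `k` cells from the first row of the larger diagram to the first row of the smaller one
is a Schur positive change of the product. -/
theorem schurPositive_row_move {P P' Q Q' : YoungDiagram} {k : ℕ}
    (hP0 : P.rowLen 0 = P'.rowLen 0 + k) (hP : ∀ i, P.rowLen (i + 1) = P'.rowLen (i + 1))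
    (hQ0 : Q'.rowLen 0 = Q.rowLen 0 + k) (hQ : ∀ i, Q'.rowLen (i + 1) = Q.rowLen (i + 1))
    (h : P'.rowLen 1 + Q.rowLen 0 ≤ P'.rowLen 0) :
    SchurPositive (schur P' * schur Q' - schur P * schur Q) := by
  classical
  set N := P.colLen 0 + Q.colLen 0 + P'.colLen 0 + Q'.colLen 0 + 1 with hN
  rw [schur_mul P' Q' (N := N) (by omega), schur_mul P Q (N := N) (by omega)]
  -- Prepending embeds one index set into the other and preserves the resulting diagrams, so the
  -- difference is the sum over the complement of the image.
  have hsub : (lrPatterns N P.rowLen Q.rowLen).image (prepend k)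
      ⊆ lrPatterns N P'.rowLen Q'.rowLen := by
    intro g' hg'
    obtain ⟨g, hg, rfl⟩ := mem_image.1 hg'
    obtain ⟨h1, h2⟩ := mem_lrPatterns.1 hg
    exact mem_lrPatterns.2
      ⟨isGT_prepend h1 (by omega) hQ0 hQ, dominant_prepend h1 h2 hP0 hP h⟩
  rw [← sum_sdiff hsub, sum_image (fun _ _ _ _ h => prepend_injective k h)]
  have heq : ∀ g ∈ lrPatterns N P.rowLen Q.rowLen,
      schur (ofRows (addWt P'.rowLen (prepend k g))) = schur (ofRows (addWt P.rowLen g)) := by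
    intro g hg
    obtain ⟨h1, h2⟩ := mem_lrPatterns.1 hg
    congr 2
    funext r
    rw [addWt, addWt, wt_prepend h1]
    cases r with
    | zero => rw [hP0, if_pos rfl]; omega
    | succ r => rw [hP, if_neg (by omega)]; omega
  rw [sum_congr rfl heq, add_sub_cancel_right]
  exact schurPositive_sum _ _

/-! ### Pieri rules -/

theorem colLen_le_of_rowLen_eq_zero {μ : YoungDiagram} {M : ℕ} (h : μ.rowLen M = 0) :
    μ.colLen 0 ≤ M := by
  by_contra hM
  have := YoungDiagram.mem_iff_lt_rowLen.1 (YoungDiagram.mem_iff_lt_colLen.2 (not_le.1 hM))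
  omega

theorem card_cells_eq_sum (μ : YoungDiagram) {M : ℕ} (hM : μ.rowLen M = 0) :
    #μ.cells = ∑ i ∈ range M, μ.rowLen i := by
  have hM' := colLen_le_of_rowLen_eq_zero hM
  have hlt : ∀ i j, (i, j) ∈ μ → SemistandardYoungTableau.highestWeight μ i j < M := by
    intro i j hc
    rw [SemistandardYoungTableau.highestWeight_apply, if_pos hc]
    have h1 := YoungDiagram.mem_iff_lt_colLen.1 hc
    have h2 := μ.colLen_anti 0 j (Nat.zero_le _)
    omega
  have h := psum_levels (SemistandardYoungTableau.highestWeight μ) M hM'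
  rw [filter_true_of_mem (fun c hc => hlt c.1 c.2 hc)] at h
  rw [← h]
  exact sum_congr rfl fun i _ => (isGT_levels _ hlt).top M i le_rfl

theorem le_iff_rowLen {μ ν : YoungDiagram} : μ ≤ ν ↔ ∀ i, μ.rowLen i ≤ ν.rowLen i := by
  constructor
  · intro h i
    by_contra hi
    have h1 : (i, ν.rowLen i) ∈ μ := YoungDiagram.mem_iff_lt_rowLen.2 (not_le.1 hi)
    exact lt_irrefl _ (YoungDiagram.mem_iff_lt_rowLen.1 (h h1))
  · rintro h ⟨i, j⟩ hc
    exact YoungDiagram.mem_iff_lt_rowLen.2 ((YoungDiagram.mem_iff_lt_rowLen.1 hc).trans_le (h i))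

/-- `ν / μ` is a horizontal strip with `k` cells. -/
structure IsHStrip (k : ℕ) (μ ν : YoungDiagram) : Prop where
  le : μ ≤ ν
  card : #ν.cells = #μ.cells + k
  strip : ∀ i j, (i + 1, j) ∈ ν → (i, j) ∈ μ

theorem isHStrip_iff {k : ℕ} {μ ν : YoungDiagram} : IsHStrip k μ ν ↔
    (∀ i, μ.rowLen i ≤ ν.rowLen i) ∧ #ν.cells = #μ.cells + k ∧
      ∀ i, ν.rowLen (i + 1) ≤ μ.rowLen i := by
  constructor
  · intro h
    refine ⟨le_iff_rowLen.1 h.le, h.card, fun i => ?_⟩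
    by_contra hi
    have h1 := h.strip i (μ.rowLen i) (YoungDiagram.mem_iff_lt_rowLen.2 (not_le.1 hi))
    exact lt_irrefl _ (YoungDiagram.mem_iff_lt_rowLen.1 h1)
  · rintro ⟨h1, h2, h3⟩
    exact ⟨le_iff_rowLen.2 h1, h2, fun i j hc => YoungDiagram.mem_iff_lt_rowLen.2
      ((YoungDiagram.mem_iff_lt_rowLen.1 hc).trans_le (h3 i))⟩

theorem card_transpose (μ : YoungDiagram) : #μ.transpose.cells = #μ.cells := by
  refine card_bij (fun c _ => c.swap) (fun c hc => ?_) (fun _ _ _ _ h => Prod.swap_injective h)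
    fun c hc => ⟨c.swap, ?_, Prod.swap_swap c⟩
  · exact YoungDiagram.mem_transpose.1 hc
  · rw [YoungDiagram.mem_cells, YoungDiagram.mem_transpose, Prod.swap_swap]; exact hc

/-- The transposed condition: `ν / μ` is a vertical strip with `k` cells. -/
theorem isHStrip_transpose_iff {k : ℕ} {μ ν : YoungDiagram} :
    IsHStrip k μ.transpose ν.transpose ↔
    (∀ i, μ.rowLen i ≤ ν.rowLen i) ∧ #ν.cells = #μ.cells + k ∧
      ∀ i, ν.rowLen i ≤ μ.rowLen i + 1 := by
  constructor
  · intro h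
    refine ⟨le_iff_rowLen.1 (YoungDiagram.transpose_le_iff.1 h.le), ?_, fun i => ?_⟩
    · rw [← card_transpose ν, h.card, card_transpose]
    · by_contra hi
      have h1 := h.strip (μ.rowLen i) i (YoungDiagram.mem_transpose.2
        (YoungDiagram.mem_iff_lt_rowLen.2 (not_le.1 hi)))
      exact lt_irrefl _ (YoungDiagram.mem_iff_lt_rowLen.1 (YoungDiagram.mem_transpose.1 h1))
  · rintro ⟨h1, h2, h3⟩
    refine ⟨YoungDiagram.transpose_le_iff.2 (le_iff_rowLen.2 h1), ?_, fun i j hc => ?_⟩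
    · rw [card_transpose, card_transpose, h2]
    · rw [YoungDiagram.mem_transpose] at hc ⊢
      have := YoungDiagram.mem_iff_lt_rowLen.1 hc
      have h4 := h3 j
      exact YoungDiagram.mem_iff_lt_rowLen.2 (by simp only at *; omega)

/-- A single row. -/
noncomputable def rowDiag (k : ℕ) : YoungDiagram := ofRows fun i => if i = 0 then k else 0

/-- A single column. -/
noncomputable def colDiag (k : ℕ) : YoungDiagram := ofRows fun i => if i < k then 1 else 0

theorem rowLen_rowDiag (k i : ℕ) : (rowDiag k).rowLen i = if i = 0 then k else 0 := by
  have h : Antitone fun i => if i = 0 then k else 0 := fun a b h => by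
    dsimp only
    split_ifs <;> omega
  exact congrFun (rowLen_ofRows h (N := 1) fun r hr => if_neg (by omega)) i

theorem rowLen_colDiag (k i : ℕ) : (colDiag k).rowLen i = if i < k then 1 else 0 := by
  have h : Antitone fun i => if i < k then 1 else 0 := fun a b h => by
    dsimp only
    split_ifs <;> omega
  exact congrFun (rowLen_ofRows h (N := k) fun r hr => if_neg (by omega)) i

theorem transpose_rowDiag (k : ℕ) : (rowDiag k).transpose = colDiag k := by
  apply YoungDiagram.ext
  ext ⟨i, j⟩
  rw [YoungDiagram.mem_cells, YoungDiagram.mem_cells, YoungDiagram.mem_transpose,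
    YoungDiagram.mem_iff_lt_rowLen, Prod.swap_prod_mk, YoungDiagram.mem_iff_lt_rowLen,
    rowLen_rowDiag, rowLen_colDiag]
  split_ifs <;> omega

theorem card_rowDiag (k : ℕ) : #(rowDiag k).cells = k := by
  rw [card_cells_eq_sum _ (M := 1) (by rw [rowLen_rowDiag, if_neg one_ne_zero])]
  simp [rowLen_rowDiag]

theorem card_colDiag (k : ℕ) : #(colDiag k).cells = k := by
  rw [← transpose_rowDiag, card_transpose, card_rowDiag]

section Pieri

variable {N : ℕ} {P Q : YoungDiagram} {g g' : ℕ → ℕ → ℕ}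

theorem IsGT.psum_top {q : ℕ → ℕ} (h : IsGT N q g) : psum g N N = ∑ i ∈ range N, q i :=
  sum_congr rfl fun i _ => h.top N i le_rfl

theorem card_addWt (hN : P.rowLen N = 0) (hg : g ∈ lrPatterns N P.rowLen Q.rowLen) :
    #(ofRows (addWt P.rowLen g)).cells = #P.cells + #Q.cells := by
  have h := (mem_lrPatterns.1 hg).1
  rw [card_cells_eq_sum P hN, card_cells_eq_sum Q (h.top_eq_zero N le_rfl), card_cells_eq_sum _ (M := N),
    rowLen_addWt hg, ← h.psum_top, ← h.sum_wt, ← sum_add_distrib]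
  · rfl
  · rw [rowLen_addWt hg, addWt, hN, h.wt_eq_zero le_rfl]

theorem wt_eq_of_ofRows_eq (hg : g ∈ lrPatterns N P.rowLen Q.rowLen)
    (hg' : g' ∈ lrPatterns N P.rowLen Q.rowLen)
    (h : ofRows (addWt P.rowLen g) = ofRows (addWt P.rowLen g')) : wt g = wt g' := by
  have h1 := rowLen_addWt hg
  rw [h, rowLen_addWt hg'] at h1
  funext r
  have := congrFun h1 r
  unfold addWt at this
  omega

theorem psum_eq_of_wt_eq {q : ℕ → ℕ} (h : IsGT N q g) (h' : IsGT N q g') (hw : wt g = wt g')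
    (r : ℕ) : psum g r r = psum g' r r := by
  rw [← h.sum_wt, ← h'.sum_wt, hw]

/-- A pattern whose top row is the row diagram. -/
theorem IsGT.psum_row {k : ℕ} (h : IsGT N (rowDiag k).rowLen g) (r i : ℕ) :
    psum g r (i + 1) = g r 0 := by
  induction i with
  | zero => simp [psum_succ]
  | succ i ih =>
    have := h.le_top r (i + 1)
    rw [rowLen_rowDiag, if_neg (by omega)] at this
    rw [psum_succ, ih]
    omega

theorem IsGT.psum_row_diag {k : ℕ} (h : IsGT N (rowDiag k).rowLen g) (r : ℕ) :
    psum g r r = g r 0 := by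
  rw [← h.psum_of_le r (Nat.le_succ r), h.psum_row]

/-- A pattern whose top row is the column diagram. -/
theorem IsGT.eq_ite_of_col {k : ℕ} (h : IsGT N (colDiag k).rowLen g) (r i : ℕ) :
    g r i = if i < psum g r r then 1 else 0 := by
  have hle : ∀ i, g r i ≤ 1 := fun i => by
    have := h.le_top r i
    rw [rowLen_colDiag] at this
    split_ifs at this <;> omega
  have key : ∀ M, (psum g r M ≤ M) ∧ ∀ i < M, g r i = if i < psum g r M then 1 else 0 := by
    intro M
    induction M with
    | zero => simp
    | succ M ih =>
      obtain ⟨h1, h2⟩ := ih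
      rw [psum_succ]
      have h3 := hle M
      refine ⟨by omega, fun i hi => ?_⟩
      by_cases hM : g r M = 0
      · rw [hM, add_zero]
        by_cases hiM : i = M
        · subst hiM; rw [hM, if_neg (by omega)]
        · exact h2 i (by omega)
      · have hall : ∀ t ∈ range M, g r t = 1 := fun t ht => by
          have h4 := h.anti r (mem_range.1 ht).le
          have h5 := hle t
          omega
        have h6 : psum g r M = M := by
          unfold psum; rw [sum_congr rfl hall]; simp
        rw [if_pos (by omega)]
        by_cases hiM : i = M
        · subst hiM; omega
        · exact hall i (mem_range.2 (by omega))
  have h1 := (key (r + i + 1)).2 i (by omega)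
  rwa [h.psum_of_le r (by omega)] at h1

theorem sum_ite_lt_min (m i : ℕ) : ∑ t ∈ range i, (if t < m then 1 else 0) = min i m := by
  induction i with
  | zero => simp
  | succ i ih =>
    rw [sum_range_succ, ih]
    split_ifs <;> omega

open Classical in
/-- The diagrams obtained by adding a horizontal strip. -/
noncomputable def hStrips (P : YoungDiagram) (k : ℕ) : Finset YoungDiagram :=
  (lrPatterns (P.colLen 0 + (rowDiag k).colLen 0 + 1) P.rowLen (rowDiag k).rowLen).image
    fun g => ofRows (addWt P.rowLen g)

theorem wt_row {k : ℕ} (h : IsGT N (rowDiag k).rowLen g) (r : ℕ) :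
    wt g r + g r 0 = g (r + 1) 0 := by
  have := h.wt_add r
  rwa [h.psum_row_diag, h.psum_row_diag] at this

/-- The partial sums of the row differences of `ν` and `P`. -/
theorem sum_sub_rowLen {ν : YoungDiagram} {k : ℕ} (h : ∀ i, P.rowLen i ≤ ν.rowLen i)
    (hc : #ν.cells = #P.cells + k) {M : ℕ} (hM : ν.rowLen M = 0) :
    ∑ i ∈ range M, (ν.rowLen i - P.rowLen i) = k := by
  have hPM : P.rowLen M = 0 := by have := h M; omega
  rw [card_cells_eq_sum ν hM, card_cells_eq_sum P hPM] at hc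
  have : ∑ i ∈ range M, ν.rowLen i
      = ∑ i ∈ range M, (ν.rowLen i - P.rowLen i) + ∑ i ∈ range M, P.rowLen i := by
    rw [← sum_add_distrib]
    exact sum_congr rfl fun i _ => by have := h i; omega
  omega

theorem mem_hStrips {k : ℕ} {ν : YoungDiagram} : ν ∈ hStrips P k ↔ IsHStrip k P ν := by
  classical
  unfold hStrips
  set N := P.colLen 0 + (rowDiag k).colLen 0 + 1 with hN
  have hPN : P.rowLen N = 0 := rowLen_eq_zero (by omega)
  rw [mem_image, isHStrip_iff]
  constructor
  · rintro ⟨g, hg, rfl⟩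
    obtain ⟨h, hD⟩ := mem_lrPatterns.1 hg
    refine ⟨fun i => ?_, ?_, fun i => ?_⟩
    · rw [rowLen_addWt hg]; exact Nat.le_add_right _ _
    · rw [card_addWt hPN hg, card_rowDiag]
    · rw [rowLen_addWt hg, addWt]
      have h1 := hD 0 i
      have h2 := wt_row h (i + 1)
      simp only [psum_succ, psum_zero] at h1
      have : g (i + 2) 0 = g (i + 1 + 1) 0 := rfl
      omega
  · rintro ⟨h1, h2, h3⟩
    have hνN : ∀ r, N ≤ r → ν.rowLen r = 0 := fun r hr => by
      have h4 := h3 (r - 1)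
      rw [Nat.sub_add_cancel (by omega), rowLen_eq_zero (μ := P) (by omega)] at h4
      omega
    -- `m r` counts the added cells in the first `r` rows; the pattern sought has this single
    -- nonzero row.
    set m : ℕ → ℕ := fun r => ∑ s ∈ range r, (ν.rowLen s - P.rowLen s) with hm
    have hms : ∀ r, m (r + 1) = m r + (ν.rowLen r - P.rowLen r) := fun r => sum_range_succ _ _
    have hGT : IsGT N (rowDiag k).rowLen fun r i => if i = 0 then m r else 0 := by
      refine ⟨fun i => ?_, fun r i hr => ?_, fun r i => ?_, fun r i => ?_⟩
      · simp [hm]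
      · rw [rowLen_rowDiag, hm]
        dsimp only
        rw [sum_sub_rowLen h1 h2 (hνN r hr)]
      · have := hms r
        split_ifs <;> omega
      · rw [if_neg (by omega)]
        exact Nat.zero_le _
    have hw : addWt P.rowLen (fun r i => if i = 0 then m r else 0) = ν.rowLen := by
      funext r
      have h4 := wt_row hGT r
      have h5 := hms r
      have h6 := h1 r
      simp only [if_true] at h4
      unfold addWt
      omega
    refine ⟨_, mem_lrPatterns.2 ⟨hGT, fun i r => ?_⟩, ?_⟩
    · have h5 := hms r
      have h6 : m (r + 2) = _ := hms (r + 1)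
      have h7 := h1 r
      have h8 := h1 (r + 1)
      have h9 := h3 r
      have h10 := P.rowLen_anti r (r + 1) (by omega)
      cases i with
      | zero => simp only [psum_succ, psum_zero, if_true]; omega
      | succ i =>
        rw [hGT.psum_row, hGT.psum_row, hGT.psum_row, hGT.psum_row]
        simp only [if_true]
        omega
    · rw [hw, ofRows_rowLen]

/-- No multiplicities occur, because a pattern with one nonzero row is recovered from its weight. -/
theorem schur_mul_row (P : YoungDiagram) (k : ℕ) :
    schur P * schur (rowDiag k) = ∑ ν ∈ hStrips P k, schur ν := by
  classical
  rw [schur_mul P _ (Nat.le_succ _), hStrips, sum_image]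
  intro g hg g' hg' h
  have hg := mem_coe.1 hg
  have hg' := mem_coe.1 hg'
  have hw := wt_eq_of_ofRows_eq hg hg' h
  obtain ⟨hg, -⟩ := mem_lrPatterns.1 hg
  obtain ⟨hg', -⟩ := mem_lrPatterns.1 hg'
  funext r i
  cases i with
  | zero => rw [← hg.psum_row_diag, ← hg'.psum_row_diag, psum_eq_of_wt_eq hg hg' hw]
  | succ i =>
    have h1 := hg.le_top r (i + 1)
    have h2 := hg'.le_top r (i + 1)
    rw [rowLen_rowDiag, if_neg (by omega)] at h1 h2
    omega

/-- By interlacing, dropping the first entry of level `r + 1` leaves at most the size of level `r`,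
and that first entry is at most 1. -/
theorem IsGT.wt_col_le {k : ℕ} (h : IsGT N (colDiag k).rowLen g) (r : ℕ) : wt g r ≤ 1 := by
  have h1 := h.wt_add r
  have h2 : psum g (r + 1) (r + 1) ≤ psum g r r + 1 := by
    have h3 := h.le_top (r + 1) 0
    rw [rowLen_colDiag] at h3
    have h4 : psum g (r + 1) (r + 1) = ∑ t ∈ range r, g (r + 1) (t + 1) + g (r + 1) 0 :=
      sum_range_succ' _ _
    have h5 : ∑ t ∈ range r, g (r + 1) (t + 1) ≤ psum g r r :=
      sum_le_sum fun t _ => h.inter r t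
    split_ifs at h3 <;> omega
  omega

theorem exists_lrPattern_col {k : ℕ} {ν : YoungDiagram}
    (hN : P.colLen 0 + (colDiag k).colLen 0 + 1 ≤ N)
    (h1 : ∀ i, P.rowLen i ≤ ν.rowLen i) (h2 : #ν.cells = #P.cells + k)
    (h3 : ∀ i, ν.rowLen i ≤ P.rowLen i + 1) :
    ∃ g ∈ lrPatterns N P.rowLen (colDiag k).rowLen, ofRows (addWt P.rowLen g) = ν := by
  set m : ℕ → ℕ := fun r => ∑ s ∈ range r, (ν.rowLen s - P.rowLen s) with hm
  have hms : ∀ r, m (r + 1) = m r + (ν.rowLen r - P.rowLen r) := fun r => sum_range_succ _ _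
  have hm0 : m 0 = 0 := rfl
  have hmono : Monotone m := monotone_nat_of_le_succ fun r => by have := hms r; omega
  have hmtop : ∀ r, ν.rowLen r = 0 → m r = k := fun r hr => sum_sub_rowLen h1 h2 hr
  have hmle : ∀ r, m r ≤ r := fun r => by
    induction r with
    | zero => exact le_rfl
    | succ r ih => have := hms r; have := h3 r; omega
  have hk : k ≤ (colDiag k).colLen 0 := by
    by_contra hk
    have h4 := rowLen_eq_zero (μ := colDiag k) le_rfl
    rw [rowLen_colDiag, if_pos (not_le.1 hk)] at h4
    omega
  have hνN : ∀ r, N ≤ r → ν.rowLen r = 0 := fun r hr => by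
    by_contra hne
    -- If row `r` of `ν` were nonempty, each row from the end of `P` up to it would contain a new
    -- cell, and there would be more than `k` of them.
    have hpos : ∀ s, P.colLen 0 ≤ s → s ≤ r → m s + P.colLen 0 ≥ s := by
      intro s hs
      induction s, hs using Nat.le_induction with
      | base => intro; omega
      | succ s hs ih =>
        intro hsr
        have h5 := hms s
        have h6 := ν.rowLen_anti s r (by omega)
        rw [rowLen_eq_zero (μ := P) hs] at h5
        have := ih (by omega)
        omega
    have h4 := hpos r (by omega) le_rfl
    have h5 := hmono (show r ≤ r + ν.colLen 0 by omega)
    rw [hmtop (r + ν.colLen 0) (rowLen_eq_zero (by omega))] at h5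
    omega
  have hGT : IsGT N (colDiag k).rowLen fun r i => if i < m r then 1 else 0 := by
    refine ⟨fun i => ?_, fun r i hr => ?_, fun r i => ?_, fun r i => ?_⟩
    · simp [hm0]
    · rw [rowLen_colDiag]
      rw [hmtop r (hνN r hr)]
    · have := hms r
      split_ifs <;> omega
    · have := hms r
      have := h3 r
      split_ifs <;> omega
  have hps : ∀ r i, psum (fun r i => if i < m r then 1 else 0) r i = min i (m r) := fun r i =>
    sum_ite_lt_min (m r) i
  have hw : addWt P.rowLen (fun r i => if i < m r then 1 else 0) = ν.rowLen := by
    funext r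
    have h4 := hGT.wt_add r
    rw [hps, hps, min_eq_right (hmle _), min_eq_right (hmle _), hms r] at h4
    have h6 := h1 r
    unfold addWt
    omega
  refine ⟨_, mem_lrPatterns.2 ⟨hGT, fun i r => ?_⟩, ?_⟩
  · rw [hps, hps, hps, hps]
    have h5 := hms r
    have h6 : m (r + 2) = _ := hms (r + 1)
    have h7 := h1 r
    have h8 := h1 (r + 1)
    have h9 := h3 r
    have h9' := h3 (r + 1)
    have h10 := P.rowLen_anti r (r + 1) (by omega)
    have h11 := ν.rowLen_anti r (r + 1) (by omega)
    omega
  · rw [hw, ofRows_rowLen]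

/-- The vertical-strip Pieri rule, indexed by the same set as the horizontal one so that the two
combine into an identity of pairs. -/
theorem schur_transpose_mul_col (P : YoungDiagram) (k : ℕ) :
    schur P.transpose * schur (colDiag k) = ∑ ν ∈ hStrips P k, schur ν.transpose := by
  classical
  rw [schur_mul P.transpose _ (Nat.le_succ _)]
  set N := (P.transpose.colLen 0 + (colDiag k).colLen 0).succ with hN
  have hPN : P.transpose.rowLen N = 0 := rowLen_eq_zero (by omega)
  refine sum_bij (fun g _ => (ofRows (addWt P.transpose.rowLen g)).transpose) ?_ ?_ ?_ ?_
  · intro g hg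
    obtain ⟨h, hD⟩ := mem_lrPatterns.1 hg
    have h1 := isHStrip_transpose_iff (k := k) (μ := P.transpose)
      (ν := ofRows (addWt P.transpose.rowLen g))
    rw [YoungDiagram.transpose_transpose] at h1
    rw [mem_hStrips, h1]
    refine ⟨fun i => ?_, ?_, fun i => ?_⟩
    · rw [rowLen_addWt hg]; exact Nat.le_add_right _ _
    · rw [card_addWt hPN hg, card_colDiag]
    · rw [rowLen_addWt hg]; exact Nat.add_le_add_left (h.wt_col_le i) _
  · intro g hg g' hg' h
    have hw := wt_eq_of_ofRows_eq hg hg' (YoungDiagram.transpose_eq_iff.1 h)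
    obtain ⟨hg, -⟩ := mem_lrPatterns.1 hg
    obtain ⟨hg', -⟩ := mem_lrPatterns.1 hg'
    funext r i
    rw [hg.eq_ite_of_col, hg'.eq_ite_of_col, psum_eq_of_wt_eq hg hg' hw]
  · intro ν hν
    rw [mem_hStrips, ← YoungDiagram.transpose_transpose P, ← YoungDiagram.transpose_transpose ν,
      isHStrip_transpose_iff] at hν
    obtain ⟨g, hg, h⟩ := exists_lrPattern_col (N := N) (by omega) hν.1 hν.2.1 hν.2.2
    exact ⟨g, hg, by rw [h, YoungDiagram.transpose_transpose]⟩
  · intro g _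
    rw [YoungDiagram.transpose_transpose]

end Pieri

/-! ### Compatibility of products with transposition -/

/-- A Schur function together with its transpose. -/
noncomputable def schurPair (ν : YoungDiagram) : MvPowerSeries ℕ ℚ × MvPowerSeries ℕ ℚ :=
  (schur ν, schur ν.transpose)

/-- The graph of the involution `s_ν ↦ s_ν'`. -/
noncomputable def omegaGraph : Submodule ℚ (MvPowerSeries ℕ ℚ × MvPowerSeries ℕ ℚ) :=
  Submodule.span ℚ (Set.range schurPair)

theorem schurPair_mem (ν : YoungDiagram) : schurPair ν ∈ omegaGraph :=
  Submodule.subset_span ⟨ν, rfl⟩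

theorem schurPair_mul_row (P : YoungDiagram) (k : ℕ) :
    schurPair (rowDiag k) * schurPair P = ∑ ν ∈ hStrips P k, schurPair ν := by
  apply Prod.ext
  · rw [Prod.fst_mul, Prod.fst_sum, mul_comm]
    exact schur_mul_row P k
  · rw [Prod.snd_mul, Prod.snd_sum, mul_comm]
    have h := schur_transpose_mul_col P k
    rwa [← transpose_rowDiag] at h

/-- Multiplication by `m` preserves the graph. -/
def Stabilizes (m : MvPowerSeries ℕ ℚ × MvPowerSeries ℕ ℚ) : Prop :=
  ∀ u ∈ omegaGraph, m * u ∈ omegaGraph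

theorem stabilizes_row (k : ℕ) : Stabilizes (schurPair (rowDiag k)) := by
  intro u hu
  induction hu using Submodule.span_induction with
  | mem x hx =>
    obtain ⟨P, rfl⟩ := hx
    rw [schurPair_mul_row]
    exact Submodule.sum_mem _ fun ν _ => schurPair_mem ν
  | zero => rw [mul_zero]; exact Submodule.zero_mem _
  | add x y _ _ hx hy => rw [mul_add]; exact Submodule.add_mem _ hx hy
  | smul a x _ hx => rw [mul_smul_comm]; exact Submodule.smul_mem _ _ hx

/-- The diagram without its first row. -/
noncomputable def tail (μ : YoungDiagram) : YoungDiagram := ofRows fun i => μ.rowLen (i + 1)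

theorem rowLen_tail (μ : YoungDiagram) (i : ℕ) : (tail μ).rowLen i = μ.rowLen (i + 1) := by
  have h : Antitone fun i => μ.rowLen (i + 1) := fun a b h => μ.rowLen_anti _ _ (by omega)
  exact congrFun (rowLen_ofRows h (N := μ.colLen 0) fun r hr => rowLen_eq_zero (by omega)) i

theorem card_eq_add_card_tail (μ : YoungDiagram) : #μ.cells = μ.rowLen 0 + #(tail μ).cells := by
  rw [card_cells_eq_sum μ (M := μ.colLen 0 + 1) (rowLen_eq_zero (by omega)),
    card_cells_eq_sum (tail μ) (M := μ.colLen 0) (by rw [rowLen_tail]; exact rowLen_eq_zero (by omega)),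
    sum_range_succ', add_comm]
  simp only [rowLen_tail]

/-- Induction on the number of cells below the first row. Multiplying the Schur pair of the tail by
that of the first row gives the pair of `P` plus pairs of diagrams with fewer cells below the first
row; solve for the pair of `P`. -/
theorem stabilizes_schurPair (P : YoungDiagram) : Stabilizes (schurPair P) := by
  classical
  induction hn : #(tail P).cells using Nat.strong_induction_on generalizing P with
  | _ n ih =>
    by_cases h1 : P.rowLen 1 = 0
    · have : P = rowDiag (P.rowLen 0) := diagram_ext fun i => by
        rw [rowLen_rowDiag]
        split_ifs with hi
        · rw [hi]
        · have := P.rowLen_anti 1 i (by omega)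
          omega
      rw [this]
      exact stabilizes_row _
    · have hP : P ∈ hStrips (tail P) (P.rowLen 0) := by
        rw [mem_hStrips, isHStrip_iff]
        refine ⟨fun i => ?_, ?_, fun i => ?_⟩
        · rw [rowLen_tail]; exact P.rowLen_anti _ _ (Nat.le_succ i)
        · rw [card_eq_add_card_tail P, add_comm]
        · rw [rowLen_tail]
      have htail : Stabilizes (schurPair (tail P)) := by
        refine ih _ ?_ (tail P) rfl
        have := card_eq_add_card_tail (tail P)
        rw [rowLen_tail, zero_add] at this
        omega
      have hsmall : ∀ ν ∈ (hStrips (tail P) (P.rowLen 0)).erase P,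
          Stabilizes (schurPair ν) := by
        intro ν hν
        obtain ⟨hne, hν⟩ := mem_erase.1 hν
        refine ih _ ?_ ν rfl
        rw [mem_hStrips, isHStrip_iff] at hν
        obtain ⟨-, h2, h3⟩ := hν
        have hle : tail ν ≤ tail P := le_iff_rowLen.2 fun i => by
          rw [rowLen_tail]; exact h3 i
        have hsub := YoungDiagram.cells_subset_iff.2 hle
        -- An equally large tail would coincide with that of `P`, and the total size would then
        -- force `ν = P`.
        rcases (card_le_card hsub).lt_or_eq with h4 | h4
        · rwa [hn] at h4
        · exfalso
          apply hne
          have h5 : tail ν = tail P := YoungDiagram.ext (eq_of_subset_of_card_le hsub h4.ge)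
          refine diagram_ext fun i => ?_
          cases i with
          | zero =>
            have := card_eq_add_card_tail ν
            omega
          | succ i => rw [← rowLen_tail, h5, rowLen_tail]
      intro u hu
      have h6 : schurPair P = schurPair (rowDiag (P.rowLen 0)) * schurPair (tail P)
          - ∑ ν ∈ (hStrips (tail P) (P.rowLen 0)).erase P, schurPair ν := by
        rw [schurPair_mul_row, ← add_sum_erase _ _ hP, add_sub_cancel_right]
      rw [h6, sub_mul, mul_assoc, sum_mul]
      exact Submodule.sub_mem _ (stabilizes_row _ _ (htail u hu))
        (Submodule.sum_mem _ fun ν hν => hsmall ν hν u hu)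

/-! ### Linear independence of Schur functions -/

/-- The sum of all letters of a content vector. -/
noncomputable def letterSum : (ℕ →₀ ℕ) →+ ℕ :=
  Finsupp.liftAddHom fun r => (AddMonoidHom.mulLeft r)

theorem letterSum_content {μ : YoungDiagram} (T : SemistandardYoungTableau μ) :
    letterSum (content T) = ∑ c ∈ μ.cells, T c.1 c.2 := by
  unfold content
  rw [map_sum]
  exact sum_congr rfl fun c _ => by simp [letterSum]

/-- The sum of the row indices of the cells. -/
def rowSum (μ : YoungDiagram) : ℕ := ∑ c ∈ μ.cells, c.1

/-- The content of the superstandard tableau. -/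
noncomputable def diagContent (μ : YoungDiagram) : ℕ →₀ ℕ :=
  content (SemistandardYoungTableau.highestWeight μ)

theorem diagContent_apply (μ : YoungDiagram) (r : ℕ) : diagContent μ r = μ.rowLen r := by
  rw [diagContent, content_apply, YoungDiagram.rowLen_eq_card, YoungDiagram.row]
  congr 1
  refine filter_congr fun c hc => ?_
  rw [SemistandardYoungTableau.highestWeight_apply, if_pos ((YoungDiagram.mem_cells _).1 hc)]

theorem letterSum_diagContent (μ : YoungDiagram) : letterSum (diagContent μ) = rowSum μ := by
  rw [diagContent, letterSum_content]
  refine sum_congr rfl fun c hc => ?_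
  rw [SemistandardYoungTableau.highestWeight_apply, if_pos ((YoungDiagram.mem_cells _).1 hc)]

theorem le_entry {μ : YoungDiagram} (T : SemistandardYoungTableau μ) {i j : ℕ}
    (hc : (i, j) ∈ μ) : i ≤ T i j := by
  induction i with
  | zero => exact Nat.zero_le _
  | succ i ih =>
    have h1 := ih (μ.up_left_mem (Nat.le_succ i) le_rfl hc)
    have h2 : T i j < T (i + 1) j := T.col_strict (show i < i + 1 by omega) hc
    omega

/-- Entries of row `i` are at least `i`, so the sum of the letters is at least the sum of the row
indices, with equality only for the superstandard tableau. This is the triangularity behind linear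
independence. -/
theorem rowSum_le_of_content {μ ν : YoungDiagram} (T : SemistandardYoungTableau ν)
    (hT : content T = diagContent μ) : rowSum ν ≤ rowSum μ ∧ (rowSum μ ≤ rowSum ν → ν = μ) := by
  have hle : ∀ c ∈ ν.cells, c.1 ≤ T c.1 c.2 := fun c hc => le_entry T hc
  have hs : rowSum μ = ∑ c ∈ ν.cells, T c.1 c.2 := by
    rw [← letterSum_content, hT, letterSum_diagContent]
  refine ⟨hs ▸ sum_le_sum hle, fun h => ?_⟩
  have heq := (sum_eq_sum_iff_of_le hle).1 (le_antisymm (sum_le_sum hle) (hs ▸ h))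
  have h2 : diagContent ν = diagContent μ := by
    rw [← hT]
    unfold diagContent content
    refine sum_congr rfl fun c hc => ?_
    rw [SemistandardYoungTableau.highestWeight_apply, if_pos ((YoungDiagram.mem_cells _).1 hc), ← heq c hc]
  exact diagram_ext fun i => by rw [← diagContent_apply, h2, diagContent_apply]

theorem schur_linearIndependent {c : YoungDiagram →₀ ℚ}
    (h : (c.sum fun ν a => a • schur ν) = 0) : c = 0 := by
  by_contra hc
  -- With `rowSum` minimal, no other diagram of the support has a tableau of content `diagContent
  -- μ`, so that coefficient isolates `c μ`.
  obtain ⟨μ, hμ, hmin⟩ := exists_min_image c.support rowSum (Finsupp.support_nonempty_iff.2 hc)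
  have h1 := congrArg (MvPowerSeries.coeff (diagContent μ)) h
  rw [Finsupp.sum, map_sum, map_zero, sum_eq_single_of_mem μ hμ] at h1
  · rw [map_smul, smul_eq_mul] at h1
    rcases mul_eq_zero.1 h1 with h2 | h2
    · exact Finsupp.mem_support_iff.1 hμ h2
    · have h3 : Nat.card {T : SemistandardYoungTableau μ // content T = diagContent μ} = 0 := by
        exact (Nat.cast_eq_zero (R := ℚ)).1 h2
      have := finite_content μ (diagContent μ)
      have : Nonempty {T : SemistandardYoungTableau μ // content T = diagContent μ} :=
        ⟨⟨SemistandardYoungTableau.highestWeight μ, rfl⟩⟩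
      exact Nat.card_pos.ne' h3
  · intro ν hν hne
    rw [map_smul, smul_eq_mul]
    apply mul_eq_zero_of_right
    have : IsEmpty {T : SemistandardYoungTableau ν // content T = diagContent μ} :=
      ⟨fun T => hne ((rowSum_le_of_content T.1 T.2).2 (hmin ν hν))⟩
    change ((Nat.card {T : SemistandardYoungTableau ν // content T = diagContent μ} : ℕ) : ℚ) = 0
    rw [Nat.card_of_isEmpty, Nat.cast_zero]

/-- Schur positivity of a difference of products is invariant under transposition. -/
theorem SchurPositive.transpose {P P' Q Q' : YoungDiagram}
    (h : SchurPositive (schur P' * schur Q' - schur P * schur Q)) :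
    SchurPositive (schur P'.transpose * schur Q'.transpose
      - schur P.transpose * schur Q.transpose) := by
  obtain ⟨c, hc, heq⟩ := h
  have hu : schurPair P' * schurPair Q' - schurPair P * schurPair Q ∈ omegaGraph :=
    Submodule.sub_mem _ (stabilizes_schurPair _ _ (schurPair_mem _))
      (stabilizes_schurPair _ _ (schurPair_mem _))
  -- The same coefficients `v` expand the difference and its transpose; independence identifies them
  -- with the nonnegative `c`.
  obtain ⟨v, hv⟩ := (Finsupp.mem_span_range_iff_exists_finsupp).1 hu
  have h1 : (v.sum fun ν a => a • schur ν) = c.sum fun ν a => a • schur ν := by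
    rw [← heq]
    have := congrArg Prod.fst hv
    rw [Finsupp.sum, Prod.fst_sum] at this
    exact this
  have hvc : v = c := by
    rw [← sub_eq_zero]
    apply schur_linearIndependent
    rw [Finsupp.sum_sub_index (by intros; rw [sub_smul]), h1, sub_self]
  have h2 : schur P'.transpose * schur Q'.transpose - schur P.transpose * schur Q.transpose
      = v.sum fun ν a => a • schur ν.transpose := by
    have := congrArg Prod.snd hv
    rw [Finsupp.sum, Prod.snd_sum] at this
    exact this.symm
  refine ⟨c.mapDomain YoungDiagram.transpose, fun ν => ?_, ?_⟩
  · have : ν = ν.transpose.transpose := (YoungDiagram.transpose_transpose ν).symm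
    rw [this, Finsupp.mapDomain_apply fun _ _ h => YoungDiagram.transpose_eq_iff.1 h]
    exact hc _
  · rw [h2, hvc, Finsupp.sum_mapDomain_index (by simp) (by intros; rw [add_smul])]

/-- Moving `k` cells from the first column of the larger diagram to the first column of the
smaller one is a Schur positive change of the product. -/
theorem schurPositive_col_move {P P' Q Q' : YoungDiagram} {k : ℕ}
    (hP0 : P.colLen 0 = P'.colLen 0 + k) (hP : ∀ i, P.colLen (i + 1) = P'.colLen (i + 1))
    (hQ0 : Q'.colLen 0 = Q.colLen 0 + k) (hQ : ∀ i, Q'.colLen (i + 1) = Q.colLen (i + 1))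
    (h : P'.colLen 1 + Q.colLen 0 ≤ P'.colLen 0) :
    SchurPositive (schur P' * schur Q' - schur P * schur Q) := by
  simp only [← YoungDiagram.rowLen_transpose] at hP0 hP hQ0 hQ h
  have := (schurPositive_row_move hP0 hP hQ0 hQ h).transpose
  simpa only [YoungDiagram.transpose_transpose] using this

/-! ### The sequence of diagrams -/

theorem rowLen_ofRowLens (w : List ℕ) (hw : w.SortedGE) (i : ℕ) :
    (YoungDiagram.ofRowLens w hw).rowLen i = w.getD i 0 := by
  apply eq_of_forall_lt_iff
  intro j
  rw [← YoungDiagram.mem_iff_lt_rowLen, YoungDiagram.mem_ofRowLens]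
  by_cases hi : i < w.length
  · rw [List.getD_eq_getElem _ _ hi]
    exact ⟨fun ⟨_, h⟩ => h, fun h => ⟨hi, h⟩⟩
  · rw [List.getD_eq_default _ _ (not_lt.1 hi)]
    exact ⟨fun ⟨h, _⟩ => absurd h hi, fun h => absurd h (Nat.not_lt_zero _)⟩

theorem rowLen_rowPart (m i : ℕ) : (rowPart m).rowLen i = if i = 0 then m else 0 := by
  rw [rowPart, rowLen_ofRowLens]
  cases i <;> simp

theorem rowLen_partAdd (μ ν : YoungDiagram) (i : ℕ) :
    (partAdd μ ν).rowLen i = μ.rowLen i + ν.rowLen i := by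
  rw [partAdd, rowLen_ofRowLens]
  by_cases hi : i < max (μ.colLen 0) (ν.colLen 0)
  · rw [List.getD_eq_getElem _ _ (by simpa using hi)]
    simp
  · rw [List.getD_eq_default _ _ (by simpa using hi), rowLen_eq_zero (μ := μ) (by omega),
      rowLen_eq_zero (μ := ν) (by omega)]

theorem rowLens_onesPart (m : ℕ) : (onesPart m).rowLens = List.replicate m 1 := by
  rw [onesPart, YoungDiagram.rowLens_ofRowLens_eq_self]
  intro x hx
  rw [List.eq_of_mem_replicate hx]
  exact Nat.one_pos

theorem rowLen_partUnion_ones (μ : YoungDiagram) (m i : ℕ) :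
    (partUnion μ (onesPart m)).rowLen i
      = if i < μ.colLen 0 then μ.rowLen i else if i < μ.colLen 0 + m then 1 else 0 := by
  have hsort : (μ.rowLens ++ List.replicate m 1).Pairwise (· ≥ ·) := by
    rw [List.pairwise_append]
    refine ⟨μ.rowLens_sorted.pairwise, List.pairwise_replicate.2 (Or.inr le_rfl), ?_⟩
    intro a ha b hb
    rw [List.eq_of_mem_replicate hb]
    exact μ.pos_of_mem_rowLens a ha
  have h : ((μ.rowLens ++ (onesPart m).rowLens : List ℕ) : Multiset ℕ).sort (· ≥ ·)
      = μ.rowLens ++ List.replicate m 1 := by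
    rw [rowLens_onesPart, Multiset.coe_sort]
    exact List.mergeSort_eq_self _ (by simpa using hsort)
  rw [partUnion, rowLen_ofRowLens, h]
  split_ifs with h1 h2
  · rw [List.getD_append _ _ _ _ (by simpa using h1),
      List.getD_eq_getElem _ _ (by simpa using h1), YoungDiagram.get_rowLens]
  · rw [List.getD_append_right _ _ _ _ (by simpa using h1), List.getD_replicate]
    rw [YoungDiagram.length_rowLens]; omega
  · rw [List.getD_eq_default]
    simp; omega

/-- The diagram `(μ ∪ (1^y)) + (x)`. -/
def stretch (μ : YoungDiagram) (x y : ℕ) : YoungDiagram :=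
  partAdd (partUnion μ (onesPart y)) (rowPart x)

theorem rowLen_stretch (μ : YoungDiagram) (x y i : ℕ) : (stretch μ x y).rowLen i
    = (if i < μ.colLen 0 then μ.rowLen i else if i < μ.colLen 0 + y then 1 else 0)
      + if i = 0 then x else 0 := by
  rw [stretch, rowLen_partAdd, rowLen_partUnion_ones, rowLen_rowPart]

theorem colLen_eq_of_forall {μ : YoungDiagram} {j m : ℕ} (h : ∀ i, j < μ.rowLen i ↔ i < m) :
    μ.colLen j = m := by
  apply eq_of_forall_lt_iff
  intro i
  rw [← YoungDiagram.mem_iff_lt_colLen, YoungDiagram.mem_iff_lt_rowLen, h]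

/-- The hypothesis excludes adding a row to an empty diagram, which would create a new cell in the
first column. -/
theorem colLen_zero_stretch (μ : YoungDiagram) {x y : ℕ} (h : μ.colLen 0 + y = 0 → x = 0) :
    (stretch μ x y).colLen 0 = μ.colLen 0 + y := by
  apply colLen_eq_of_forall
  intro i
  rw [rowLen_stretch]
  by_cases h1 : i < μ.colLen 0
  · have : 0 < μ.rowLen i :=
      YoungDiagram.mem_iff_lt_rowLen.1 (YoungDiagram.mem_iff_lt_colLen.2 h1)
    rw [if_pos h1]
    omega
  · rw [if_neg h1]
    split_ifs <;> omega

theorem colLen_succ_stretch (μ : YoungDiagram) {x y z : ℕ} (c : ℕ) (h : μ.colLen 0 + y = 0 → x = 0) :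
    (stretch μ x (y + z)).colLen (c + 1) = (stretch μ x y).colLen (c + 1) := by
  apply colLen_eq_of_forall
  intro i
  rw [← YoungDiagram.mem_iff_lt_colLen, YoungDiagram.mem_iff_lt_rowLen, rowLen_stretch,
    rowLen_stretch]
  split_ifs <;> omega

/-- Appended parts 1 never reach the second column, and lengthening the first row can only fill its
top cell; hence the maximum with 1. -/
theorem colLen_one_stretch_le (μ : YoungDiagram) (x y : ℕ) :
    (stretch μ x y).colLen 1 ≤ max (μ.colLen 1) 1 := by
  by_contra hlt
  have h := YoungDiagram.mem_iff_lt_rowLen.1 (YoungDiagram.mem_iff_lt_colLen.2 (not_le.1 hlt))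
  rw [rowLen_stretch, if_neg (show max (μ.colLen 1) 1 ≠ 0 by omega)] at h
  split_ifs at h with h1
  · have := YoungDiagram.mem_iff_lt_colLen.1 (YoungDiagram.mem_iff_lt_rowLen.2 h)
    omega
  all_goals omega

/-- Cells of the first column can be moved one step along the sequence. -/
theorem schurPositive_stretch_col (μ : YoungDiagram) (j k : ℕ)
    (hj : j = 0 ∨ μ.colLen 1 ≤ j) {m n : ℕ} (hmn : n < m) :
    SchurPositive (schur (stretch μ ((m + 1) * k) (m * j)) * schur (stretch μ (n * k) ((n + 1) * j))
      - schur (stretch μ ((m + 1) * k) ((m + 1) * j)) * schur (stretch μ (n * k) (n * j))) := by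
  rcases Nat.eq_zero_or_pos j with rfl | hj0
  · simp only [mul_zero, sub_self]
    exact schurPositive_zero
  have hj1 : μ.colLen 1 ≤ j := by omega
  have hm : 0 < m * j := Nat.mul_pos (by omega) hj0
  have hn : μ.colLen 0 + n * j = 0 → n * k = 0 := fun h => by
    have h1 : n * j = 0 := by omega
    rcases Nat.mul_eq_zero.1 h1 with h2 | h2
    · rw [h2, zero_mul]
    · omega
  have e1 : (m + 1) * j = m * j + j := Nat.succ_mul m j
  have e2 : (n + 1) * j = n * j + j := Nat.succ_mul n j
  have e3 : (n + 1) * j ≤ m * j := Nat.mul_le_mul_right j hmn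
  have hP := colLen_zero_stretch μ (x := (m + 1) * k) (y := m * j) (by omega)
  have hQ := colLen_zero_stretch μ hn
  rw [e1, e2]
  refine schurPositive_col_move (k := j) ?_ (fun i => ?_) ?_ (fun i => ?_) ?_
  · rw [colLen_zero_stretch μ (by omega), hP]; omega
  · exact colLen_succ_stretch μ i (by omega)
  · rw [colLen_zero_stretch μ (by omega), hQ]; omega
  · exact colLen_succ_stretch μ i hn
  -- The second column has length at most `max (μ.colLen 1) 1 ≤ j`, while the first columns differ
  -- by `(m - n) * j ≥ j`.
  · have := colLen_one_stretch_le μ ((m + 1) * k) (m * j)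
    rw [hP, hQ]
    omega

/-- Cells of the first row can be moved one step along the sequence. -/
theorem schurPositive_stretch_row (μ : YoungDiagram) (j k : ℕ)
    (hk : k = 0 ∨ μ.rowLen 1 ≤ k) {m n : ℕ} (hmn : n < m) :
    SchurPositive (schur (stretch μ (m * k) (m * j)) * schur (stretch μ ((n + 1) * k) ((n + 1) * j))
      - schur (stretch μ ((m + 1) * k) (m * j)) * schur (stretch μ (n * k) ((n + 1) * j))) := by
  rcases Nat.eq_zero_or_pos k with rfl | hk0
  · simp only [mul_zero, sub_self]
    exact schurPositive_zero
  have hk1 : μ.rowLen 1 ≤ k := by omega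
  have e1 : (m + 1) * k = m * k + k := Nat.succ_mul m k
  have e2 : (n + 1) * k = n * k + k := Nat.succ_mul n k
  have e3 : (n + 1) * k ≤ m * k := Nat.mul_le_mul_right k hmn
  have e4 : (n + 1) * j ≤ m * j := Nat.mul_le_mul_right j hmn
  rw [e1, e2]
  refine schurPositive_row_move (k := k) ?_ (fun i => ?_) ?_ (fun i => ?_) ?_
  · rw [rowLen_stretch, rowLen_stretch, if_pos rfl, if_pos rfl, add_assoc]
  · simp only [rowLen_stretch, Nat.succ_ne_zero, if_false]
  · rw [rowLen_stretch, rowLen_stretch, if_pos rfl, if_pos rfl, add_assoc]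
  · simp only [rowLen_stretch, Nat.succ_ne_zero, if_false]
  -- The second row is that of `μ`, an appended part 1, or empty, hence at most `k`; the first rows
  -- differ by at least `(m - n) * k ≥ k`.
  · have e5 : 0 < m * j → 0 < (n + 1) * j := fun h =>
      Nat.mul_pos (Nat.succ_pos n) (Nat.pos_of_mul_pos_left h)
    simp only [rowLen_stretch, one_ne_zero, if_false, if_true]
    split_ifs <;> omega

end

end SchurLC

theorem theoremA (μ : YoungDiagram) (j k : ℕ)
    (hk : k = 0 ∨ μ.rowLen 1 ≤ k) (hj : j = 0 ∨ μ.transpose.rowLen 1 ≤ j) :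
    SchurLC.StronglySchurLogConcave fun n =>
      SchurLC.schur
        (SchurLC.partAdd (SchurLC.partUnion μ (SchurLC.onesPart (n * j)))
          (SchurLC.rowPart (n * k))) := by
  intro n i hn
  obtain ⟨n, rfl⟩ : ∃ n', n = n' + 1 := ⟨n - 1, by omega⟩
  rw [YoungDiagram.rowLen_transpose] at hj
  -- The two moves share the product with first rows `(m + 1) * k`, `n * k` and columns `m * j`, `(n
  -- + 1) * j` added, which cancels in the sum.
  have h := (SchurLC.schurPositive_stretch_row μ j k hk (m := n + 1 + i) (n := n) (by omega)).add
    (SchurLC.schurPositive_stretch_col μ j k hj (m := n + 1 + i) (n := n) (by omega))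
  rw [sub_add_sub_cancel] at h
  exact h
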